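/- **Setting.** Fix real constants $m,\chi,\mathrm c>0$ and $q$. A *trajectory* is a twice continuously differentiable curve $\hat{\mathbf r}:[T_-,T_+]\to\mathbb R^3$, $T_-<T_+$, with bounded $\hat{\mathbf v}=\partial_t\hat{\mathbf r}$ and $\partial_t^2\hat{\mathbf r}$ (one-sided derivatives at the ends). For $R_n>0$ put $\Omega_n(t)=\{|\mathbf x-\hat{\mathbf r}(t)|\le R_n\}$, $\hat\Omega_n=\{(t,\mathbf x):T_-\le t\le T_+,\ \mathbf x\in\Omega_n(t)\}$; $\bar{\mathbf n}$ is the outer unit normal of $\partial\Omega_n$ and $\partial_0=\mathrm c^{-1}\partial_t$, $\nabla_{0,\mathbf x}=(\partial_0,\partial_1,\partial_2,\partial_3)$. Constants $C$ do not depend on $n$, $t$, $\mathbf x$. *Nonlinearity.* $G_1:[0,\infty)\to\mathbb R$ is continuous, differentiable on $(0,\infty)$ with continuous derivative $G_1'$; the function $\psi\mapsto G_1(\psi^*\psi)$ is differentiable on $\mathbb C$ with $dG_1(\psi^*\psi)=g(\psi)\,d\psi^*+g(\psi)^*\,d\psi$, where $g(\psi)=G_1'(|\psi|^2)\psi$ for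 $\psi\ne0$, $g(0)=0$, and $g$ is continuous. For $a>0$ put $G_a(s)=a^{-5}G_1(a^3s)$, so that $G_a'(s)=a^{-2}G_1'(a^3s)$; $G_a'(|\psi|^2)\psi$ is read as $0$ where $\psi=0$. *Equation and densities.* For real potentials $\varphi$, $\mathbf A$ let $\tilde\partial_t=\partial_t+\frac{\mathrm iq}{\chi}\varphi$, $\tilde\nabla=\nabla-\frac{\mathrm iq}{\chi\mathrm c}\mathbf A$, $\mathbf E=-\nabla\varphi-\frac1{\mathrm c}\partial_t\mathbf A$, $\mathbf B=\nabla\times\mathbf A$. The NLS equation is $$\mathrm i\tilde\partial_t\psi=\frac{\chi}{2m}\left[-\tilde\nabla^2\psi+G_a'(\psi^*\psi)\psi\right].$$ Put $\rho=q|\psi|^2$, $\mathbf J=-\mathrm i\frac{q\chi}{2m}(\psi^*\tilde\nabla\psi-\psi\tilde\nabla^*\psi^*)$, $\mathbf P=\mathrm i\frac{\chi}{2}(\psi\tilde\nabla^*\psi^*-\psi^*\tilde\nabla\psi)$, $u=\frac{\chi^2}{2m}\left(|\tilde\nabla\psi|^2+G_a(|\psi|^2)\right)$, and $$T^{ii}=u-\tfrac{\chi^2}{m}|\tilde\partial_i\psi|^2+\tfrac{\mathrm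 i\chi}{2}(\psi\tilde\partial_t^*\psi^*-\psi^*\tilde\partial_t\psi),\qquad T^{ij}=-\tfrac{\chi^2}{2m}(\tilde\partial_i\psi\,\tilde\partial_j^*\psi^*+\tilde\partial_j\psi\,\tilde\partial_i^*\psi^*)\quad(i\ne j).$$ *Localized equations.* Let $a_n>0$, $a_n\to0$, $R_n\to0$, $R_n/a_n\to\infty$, and let $\varphi_n,\mathbf A_n\in C^2(\hat\Omega_n)$. Let $$\varphi_\infty(t,\mathbf x)=\varphi_\infty(t)+(\mathbf x-\hat{\mathbf r}(t))\cdot\nabla\varphi_\infty(t),\qquad \mathbf A_\infty(t,\mathbf x)=\mathbf A_\infty(t)+(\mathbf x-\hat{\mathbf r}(t))\cdot\nabla\mathbf A_\infty(t)$$ be the limit linear potentials, whose coefficients are differentiable in $t\in[T_-,T_+]$, and such that $\varphi_\infty,\mathbf A_\infty,\nabla_{0,\mathbf x}\varphi_\infty,\nabla_{0,\mathbf x}\mathbf A_\infty$ are bounded on the trajectory. Assume that $|\varphi_n|,|\nabla_{0,\mathbf x}\varphi_n|,|\mathbf A_n|,|\nabla_{0,\mathbf x}\mathbf A_n|\le C$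 on $\hat\Omega_n$ and that, as $n\to\infty$, $$\sup_{\hat\Omega_n}\left(|\varphi_n-\varphi_\infty|+|\nabla_{0,\mathbf x}\varphi_n-\nabla_{0,\mathbf x}\varphi_\infty|\right)\to0,\qquad \sup_{\hat\Omega_n}\left(|\mathbf A_n-\mathbf A_\infty|+|\nabla_{0,\mathbf x}\mathbf A_n-\nabla_{0,\mathbf x}\mathbf A_\infty|\right)\to0.$$ The limit fields at the trajectory are $$\mathbf E_\infty(t)=\left(-\nabla\varphi_\infty-\tfrac1{\mathrm c}\partial_t\mathbf A_\infty\right)(t,\hat{\mathbf r}(t)),\qquad \mathbf B_\infty(t)=(\nabla\times\mathbf A_\infty)(t,\hat{\mathbf r}(t)).$$ *Concentrating solutions.* Let $\psi_n\in C^2(\hat\Omega_n)$ solve the NLS equation with $a=a_n$, $\varphi=\varphi_n$, $\mathbf A=\mathbf A_n$ in $\hat\Omega_n$, let $\rho_n,\mathbf J_n,\mathbf P_n,T_n^{ij},\mathbf E_n,\mathbf B_n$ be the corresponding quantities, and put $$\bar\rho_n(t)=\int_{\Omega_n(t)}\rho_n\,d\mathbf x,\qquad \mathbf r_n(t)=\frac1{\bar\rho_n(t)}\int_{\Omega_n(t)}\mathbf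 x\rho_n\,d\mathbf x,\qquad \mathbf v_n=\partial_t\mathbf r_n .$$ The $\psi_n$ *concentrate* at $\hat{\mathbf r}$, with $t_0\in[T_-,T_+]$ and limit charge $\bar\rho_\infty$, if: $\left|\int_{\Omega_n(t)}\mathbf P_n\,d\mathbf x\right|\le C$ for all $n$ and $t$; $C\ge\bar\rho_n(t)\ge c_0>0$ for $n\ge n_0$ and all $t$; $\bar\rho_n(t_0)\to\bar\rho_\infty$; and the following quantities tend to $0$ uniformly in $t\in[T_-,T_+]$: $$\int_{t_0}^t\!\int_{\partial\Omega_n}\bar n_iT_n^{ij}\,d\sigma dt'\ (j=1,2,3),\qquad \int_{t_0}^t\!\int_{\partial\Omega_n}\mathbf P_n\,\hat{\mathbf v}\cdot\bar{\mathbf n}\,d\sigma dt',\qquad \int_{\partial\Omega_n}(\mathbf x-\mathbf r_n)\,\hat{\mathbf v}\cdot\bar{\mathbf n}\,\rho_n\,d\sigma,$$ $$\int_{\partial\Omega_n}(\mathbf x-\mathbf r_n)\,\bar{\mathbf n}\cdot\mathbf J_n\,d\sigma,\qquad \int_{t_0}^t\!\int_{\partial\Omega_n}\hat{\mathbf v}\cdot\bar{\mathbf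 n}\,\rho_n\,d\sigma dt'-\int_{t_0}^t\!\int_{\partial\Omega_n}\bar{\mathbf n}\cdot\mathbf J_n\,d\sigma dt',$$ $$\int_{t_0}^t\left(\int_{\Omega_n}(\mathbf E_n-\mathbf E_\infty)\rho_n\,d\mathbf x+\int_{\Omega_n}\tfrac1{\mathrm c}\mathbf J_n\times(\mathbf B_n-\mathbf B_\infty)\,d\mathbf x\right)dt'.$$ **Theorem.** Let $\psi_n$ concentrate at the trajectory $\hat{\mathbf r}$. Then: 1. $\mathbf E_\infty$ and $\mathbf B_\infty$ are continuous on $[T_-,T_+]$, and $\mathbf r_n$ is continuously differentiable there for all large $n$. There are a subsequence and a vector $\mathbf p_\infty$ such that, along the subsequence, $\int_{\Omega_n(t_0)}\mathbf P_n(t_0)\,d\mathbf x\to\mathbf p_\infty$. For every subsequence and every $\mathbf p_\infty$ with this property, the velocities of the adjacent centers satisfy, for all large $n$ of the subsequence and all $t\in[T_-,T_+]$, $$\frac mq\bar\rho_\infty\mathbf v_n(t)=\int_{t_0}^t\left(\bar\rho_\infty\mathbf E_\infty(t')+\bar\rho_\infty\mathbf v_n(t')\times\tfrac1{\mathrm c}\mathbf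 B_\infty(t')\right)dt'+\mathbf p_\infty+\mathbf Q_6(t),$$ where $\mathbf Q_6=\mathbf Q_{6,n}\to0$ uniformly on $[T_-,T_+]$. 2. The trajectory satisfies, for all $t\in[T_-,T_+]$, $$m\,\partial_t^2\hat{\mathbf r}(t)=q\,\mathbf E_\infty(t)+\frac q{\mathrm c}\,\partial_t\hat{\mathbf r}(t)\times\mathbf B_\infty(t).$$ -/

import Mathlib

open Set Filter Topology MeasureTheory

noncomputable section

namespace NLSPoint

/-! ### Vector calculus in space and time -/

/-- Physical space `ℝ³` with its Euclidean norm. -/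
abbrev E3 : Type := EuclideanSpace ℝ (Fin 3)

/-- Space-time points `(t, x)`. -/
abbrev ST : Type := ℝ × E3

/-- The cross product on `ℝ³`. -/
def cross (u v : E3) : E3 := WithLp.toLp 2 (crossProduct u.ofLp v.ofLp)

section Derivatives

variable {V : Type*} [NormedAddCommGroup V] [NormedSpace ℝ V]

/-- The time derivative `∂ₜ F` at `p`. Functions live on a (closed) space-time domain `D`, so
derivatives are taken within `D`: they are ordinary derivatives in the interior of `D` and
one-sided ones at its boundary. -/
def dt (D : Set ST) (F : ST → V) (p : ST) : V := fderivWithin ℝ F D p (1, 0)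

/-- The spatial derivative `∂ᵢ F` at `p`, for functions on `D`. -/
def dx (D : Set ST) (i : Fin 3) (F : ST → V) (p : ST) : V :=
  fderivWithin ℝ F D p (0, EuclideanSpace.single i (1 : ℝ))

/-- `∇_{0,x} F = (c⁻¹ ∂ₜ F, ∂₁ F, ∂₂ F, ∂₃ F)`, with the Euclidean norm of the four entries. -/
def grad0 (c : ℝ) (D : Set ST) (F : ST → V) (p : ST) : PiLp 2 (fun _ : Fin 4 => V) :=
  WithLp.toLp 2 (Fin.cons (c⁻¹ • dt D F p) (fun i : Fin 3 => dx D i F p))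

end Derivatives

/-- The spatial gradient of a scalar function. -/
def grad (D : Set ST) (F : ST → ℝ) (p : ST) : E3 := WithLp.toLp 2 (fun i => dx D i F p)

/-- The spatial curl of a vector field. -/
def curl (D : Set ST) (F : ST → E3) (p : ST) : E3 :=
  !₂[dx D 1 F p 2 - dx D 2 F p 1, dx D 2 F p 0 - dx D 0 F p 2, dx D 0 F p 1 - dx D 1 F p 0]

/-- The electric field `E = -∇φ - c⁻¹ ∂ₜ A`. -/
def electric (c : ℝ) (D : Set ST) (φ : ST → ℝ) (A : ST → E3) (p : ST) : E3 :=
  -grad D φ p - c⁻¹ • dt D A p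

/-- The magnetic field `B = ∇ × A`. -/
def magnetic (D : Set ST) (A : ST → E3) (p : ST) : E3 := curl D A p

/-- The surface integral over the sphere `|x - x₀| = R` of `f x n`, where `n` is the outer unit
normal at `x`. Here `volume.toSphere` is the surface area measure of the unit sphere. -/
def surfaceIntegral {V : Type*} [NormedAddCommGroup V] [NormedSpace ℝ V]
    (x₀ : E3) (R : ℝ) (f : E3 → E3 → V) : V :=
  R ^ 2 • ∫ ω : Metric.sphere (0 : E3) 1, f (x₀ + R • (ω : E3)) (ω : E3)
    ∂((volume : Measure E3).toSphere)

/-! ### Constants, trajectories, nonlinearities -/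

/-- The fixed constants: mass `m`, charge `q`, the Planck-like constant `χ`, speed of light `c`. -/
structure Constants where
  m : ℝ
  q : ℝ
  χ : ℝ
  c : ℝ
  m_pos : 0 < m
  χ_pos : 0 < χ
  c_pos : 0 < c

/-- A trajectory: a twice continuously differentiable curve on `[T₋, T₊]` with bounded velocity and
acceleration. -/
structure Trajectory where
  Tm : ℝ
  Tp : ℝ
  lt : Tm < Tp
  pos : ℝ → E3
  contDiffOn : ContDiffOn ℝ 2 pos (Icc Tm Tp)
  bounded : ∃ C : ℝ, ∀ t ∈ Icc Tm Tp, ‖derivWithin pos (Icc Tm Tp) t‖ ≤ C ∧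
    ‖derivWithin (derivWithin pos (Icc Tm Tp)) (Icc Tm Tp) t‖ ≤ C

namespace Trajectory

/-- The time interval `[T₋, T₊]`. -/
def I (γ : Trajectory) : Set ℝ := Icc γ.Tm γ.Tp

/-- The velocity of the trajectory. -/
def vel (γ : Trajectory) (t : ℝ) : E3 := derivWithin γ.pos γ.I t

/-- The acceleration of the trajectory. -/
def acc (γ : Trajectory) (t : ℝ) : E3 := derivWithin γ.vel γ.I t

/-- The ball `Ω(r̂(t), R)`. -/
def ball (γ : Trajectory) (R t : ℝ) : Set E3 := Metric.closedBall (γ.pos t) R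

/-- The tubular neighbourhood of radius `R`. -/
def tube (γ : Trajectory) (R : ℝ) : Set ST := {p | p.1 ∈ γ.I ∧ p.2 ∈ γ.ball R p.1}

/-- The slab `[T₋, T₊] × ℝ³`, on which the limit linear potentials are defined. -/
def slab (γ : Trajectory) : Set ST := γ.I ×ˢ univ

end Trajectory

/-- The continuous version `g` of `G₁'(|z|²) z`, which is `0` at `z = 0`. -/
def nonlinTerm (G' : ℝ → ℝ) (z : ℂ) : ℂ := if z = 0 then 0 else (G' (Complex.normSq z) : ℂ) * z

/-- The regularity condition on the nonlinearity `G₁'` and its potential `G₁`. -/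
structure Nonlinearity where
  G : ℝ → ℝ
  G' : ℝ → ℝ
  continuousOn_G' : ContinuousOn G' (Ioi 0)
  hasDerivAt_G : ∀ s, 0 < s → HasDerivAt G (G' s) s
  continuousOn_G : ContinuousOn G (Ici 0)
  /-- `d G₁(z* z) = g(z) dz* + g(z)* dz`. -/
  differential : ∀ z : ℂ, ∃ L : ℂ →L[ℝ] ℝ,
    HasFDerivAt (fun w : ℂ => G (Complex.normSq w)) L z ∧
    ∀ w : ℂ, (L w : ℂ) = nonlinTerm G' z * star w + star (nonlinTerm G' z) * w
  continuous_g : Continuous (nonlinTerm G')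

/-- `G_a'(s) = a⁻² G₁'(a³ s)`. -/
def Nonlinearity.scaled' (N : Nonlinearity) (a s : ℝ) : ℝ := (a ^ 2)⁻¹ * N.G' (a ^ 3 * s)

/-- `G_a(s) = a⁻⁵ G₁(a³ s)`, the potential of `G_a'`. -/
def Nonlinearity.scaled (N : Nonlinearity) (a s : ℝ) : ℝ := (a ^ 5)⁻¹ * N.G (a ^ 3 * s)

/-! ### The NLS equation and its densities -/

section Densities

variable (K : Constants) (N : Nonlinearity) (a : ℝ) (D : Set ST)
  (φ : ST → ℝ) (A : ST → E3) (ψ : ST → ℂ)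

/-- Covariant time derivative `∂ₜ ψ + (i q / χ) φ ψ`. -/
def covT (p : ST) : ℂ := dt D ψ p + (Complex.I * K.q / K.χ) * φ p * ψ p

/-- Covariant spatial derivative `∂ᵢ ψ - (i q / (χ c)) Aᵢ ψ`. -/
def covX (i : Fin 3) (p : ST) : ℂ := dx D i ψ p - (Complex.I * K.q / (K.χ * K.c)) * A p i * ψ p

/-- The nonlinear Schrödinger equation
`i ∂̃ₜ ψ = (χ / 2m) (-∇̃² ψ + G_a'(|ψ|²) ψ)` at every point of `D`. The nonlinear term is read as
`0` where `ψ = 0`. -/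
def SolvesNLS : Prop :=
  ∀ p ∈ D, Complex.I * covT K D φ ψ p =
    (K.χ / (2 * K.m) : ℂ) * (-(∑ i : Fin 3, covX K D A (covX K D A ψ i) i p) +
      nonlinTerm (N.scaled' a) (ψ p))

/-- Charge density `ρ = q |ψ|²`. -/
def chargeDensity (p : ST) : ℝ := K.q * Complex.normSq (ψ p)

/-- Current density `J = -i (qχ / 2m) (ψ* ∇̃ψ - ψ ∇̃*ψ*)`; each entry is a real number. -/
def current (p : ST) : E3 :=
  WithLp.toLp 2 fun i : Fin 3 => (-Complex.I * (K.q * K.χ / (2 * K.m)) *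
    (star (ψ p) * covX K D A ψ i p - ψ p * star (covX K D A ψ i p))).re

/-- Momentum density `P = i (χ / 2) (ψ ∇̃*ψ* - ψ* ∇̃ψ)`; each entry is a real number. -/
def momentum (p : ST) : E3 :=
  WithLp.toLp 2 fun i : Fin 3 => (Complex.I * (K.χ / 2) *
    (ψ p * star (covX K D A ψ i p) - star (ψ p) * covX K D A ψ i p)).re

/-- Energy density `u = (χ² / 2m) (|∇̃ψ|² + G_a(|ψ|²))`. -/
def energyDensity (p : ST) : ℝ :=
  K.χ ^ 2 / (2 * K.m) *
    ((∑ i : Fin 3, Complex.normSq (covX K D A ψ i p)) + N.scaled a (Complex.normSq (ψ p)))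

/-- The spatial entries `T^{ij}` of the energy-momentum tensor. -/
def stress (i j : Fin 3) (p : ST) : ℝ :=
  if i = j then
    energyDensity K N a D A ψ p - K.χ ^ 2 / K.m * Complex.normSq (covX K D A ψ i p) +
      (Complex.I * (K.χ / 2) *
        (ψ p * star (covT K D φ ψ p) - star (ψ p) * covT K D φ ψ p)).re
  else
    -(K.χ ^ 2 / (2 * K.m)) *
      (covX K D A ψ i p * star (covX K D A ψ j p) +
        covX K D A ψ j p * star (covX K D A ψ i p)).re

end Densities

/-! ### Localized NLS equations -/

/-- The data of a sequence of NLS equations near a trajectory: radii `Rₙ`, size parameters `aₙ`,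
potentials `φₙ, Aₙ`, and the coefficients of the limit linear potentials. -/
structure NLSSequence where
  R : ℕ → ℝ
  a : ℕ → ℝ
  φ : ℕ → ST → ℝ
  A : ℕ → ST → E3
  φ₀ : ℝ → ℝ
  gradφ : ℝ → E3
  A₀ : ℝ → E3
  gradA : ℝ → (E3 →L[ℝ] E3)

namespace NLSSequence

variable (K : Constants) (γ : Trajectory) (S : NLSSequence)

/-- The limit scalar potential `φ_∞(t,x) = φ_∞(t) + (x - r̂(t)) · ∇φ_∞(t)`. -/
def φlim (p : ST) : ℝ := S.φ₀ p.1 + inner ℝ (p.2 - γ.pos p.1) (S.gradφ p.1)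

/-- The limit vector potential `A_∞(t,x) = A_∞(t) + (x - r̂(t)) · ∇A_∞(t)`. -/
def Alim (p : ST) : E3 := S.A₀ p.1 + S.gradA p.1 (p.2 - γ.pos p.1)

/-- The limit electric field at the trajectory. -/
def Elim (t : ℝ) : E3 := electric K.c γ.slab (S.φlim γ) (S.Alim γ) (t, γ.pos t)

/-- The limit magnetic field at the trajectory. -/
def Blim (t : ℝ) : E3 := magnetic γ.slab (S.Alim γ) (t, γ.pos t)

/-- The `n`-th tubular neighbourhood. -/
def tube (n : ℕ) : Set ST := γ.tube (S.R n)

/-- The NLS equations are localized at the trajectory. -/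
structure IsLocalized : Prop where
  R_pos : ∀ n, 0 < S.R n
  a_pos : ∀ n, 0 < S.a n
  R_tendsto : Tendsto S.R atTop (𝓝 0)
  a_tendsto : Tendsto S.a atTop (𝓝 0)
  ratio_tendsto : Tendsto (fun n => S.R n / S.a n) atTop atTop
  /-- The coefficients are differentiable in time, so that the time derivatives of the limit
  potentials below make sense. -/
  φ₀_diff : DifferentiableOn ℝ S.φ₀ γ.I
  gradφ_diff : DifferentiableOn ℝ S.gradφ γ.I
  A₀_diff : DifferentiableOn ℝ S.A₀ γ.I
  gradA_diff : DifferentiableOn ℝ S.gradA γ.I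
  φlim_bounded : ∃ C : ℝ, ∀ t ∈ γ.I, |S.φlim γ (t, γ.pos t)| ≤ C ∧
    ‖grad0 K.c γ.slab (S.φlim γ) (t, γ.pos t)‖ ≤ C
  Alim_bounded : ∃ C : ℝ, ∀ t ∈ γ.I, ‖S.Alim γ (t, γ.pos t)‖ ≤ C ∧
    ‖grad0 K.c γ.slab (S.Alim γ) (t, γ.pos t)‖ ≤ C
  φ_contDiffOn : ∀ n, ContDiffOn ℝ 2 (S.φ n) (S.tube γ n)
  A_contDiffOn : ∀ n, ContDiffOn ℝ 2 (S.A n) (S.tube γ n)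
  φ_tendsto : ∀ ε > 0, ∀ᶠ n in atTop, ∀ p ∈ S.tube γ n,
    |S.φ n p - S.φlim γ p| +
      ‖grad0 K.c (S.tube γ n) (S.φ n) p - grad0 K.c γ.slab (S.φlim γ) p‖ ≤ ε
  A_tendsto : ∀ ε > 0, ∀ᶠ n in atTop, ∀ p ∈ S.tube γ n,
    ‖S.A n p - S.Alim γ p‖ +
      ‖grad0 K.c (S.tube γ n) (S.A n) p - grad0 K.c γ.slab (S.Alim γ) p‖ ≤ ε
  φ_bounded : ∃ C : ℝ, ∀ n, ∀ p ∈ S.tube γ n,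
    |S.φ n p| ≤ C ∧ ‖grad0 K.c (S.tube γ n) (S.φ n) p‖ ≤ C
  A_bounded : ∃ C : ℝ, ∀ n, ∀ p ∈ S.tube γ n,
    ‖S.A n p‖ ≤ C ∧ ‖grad0 K.c (S.tube γ n) (S.A n) p‖ ≤ C

/-! ### Concentrating solutions -/

variable (N : Nonlinearity) (ψ : ℕ → ST → ℂ) (t₀ : ℝ) (n : ℕ)

/-- The charge density `ρₙ`. -/
def ρ (p : ST) : ℝ := chargeDensity K (ψ n) p

/-- The current density `Jₙ`. -/
def J (p : ST) : E3 := current K (S.tube γ n) (S.A n) (ψ n) p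

/-- The momentum density `Pₙ`. -/
def P (p : ST) : E3 := momentum K (S.tube γ n) (S.A n) (ψ n) p

/-- The tensor entries `Tₙ^{ij}`. -/
def T (i j : Fin 3) (p : ST) : ℝ :=
  stress K N (S.a n) (S.tube γ n) (S.φ n) (S.A n) (ψ n) i j p

/-- The electric field `Eₙ`. -/
def E (p : ST) : E3 := electric K.c (S.tube γ n) (S.φ n) (S.A n) p

/-- The magnetic field `Bₙ`. -/
def B (p : ST) : E3 := magnetic (S.tube γ n) (S.A n) p

/-- The adjacent charge value: the charge in the ball `Ωₙ(t)`. -/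
def charge (t : ℝ) : ℝ := ∫ x in γ.ball (S.R n) t, ρ K ψ n (t, x)

/-- The momentum in the ball `Ωₙ(t)`. -/
def totalMomentum (t : ℝ) : E3 := ∫ x in γ.ball (S.R n) t, S.P K γ ψ n (t, x)

/-- The adjacent charge center `rₙ(t)`. -/
def center (t : ℝ) : E3 :=
  (S.charge K γ ψ n t)⁻¹ • ∫ x in γ.ball (S.R n) t, ρ K ψ n (t, x) • x

/-- The velocity `vₙ(t)` of the adjacent charge center. -/
def centerVel (t : ℝ) : E3 := derivWithin (S.center K γ ψ n) γ.I t

/-- The integral over `∂Ωₙ(t)` of `f x n̄`. -/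
def bdryIntegral {V : Type*} [NormedAddCommGroup V] [NormedSpace ℝ V] (t : ℝ) (f : E3 → E3 → V) :
    V :=
  surfaceIntegral (γ.pos t) (S.R n) f

/-- `Q₀ = ∫_{t₀}^t ∫_{∂Ωₙ} n̄ᵢ T^{ij} dσ dt'`. -/
def Q0 (t : ℝ) : E3 :=
  ∫ τ in t₀..t, S.bdryIntegral γ n τ fun x ν =>
    (WithLp.toLp 2 fun j : Fin 3 => ∑ i : Fin 3, ν i * S.T K γ N ψ n i j (τ, x) : E3)

/-- `Q₀₁ = ∫_{t₀}^t ∫_{∂Ωₙ} P (v̂ · n̄) dσ dt'`. -/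
def Q01 (t : ℝ) : E3 :=
  ∫ τ in t₀..t, S.bdryIntegral γ n τ fun x ν => inner ℝ (γ.vel τ) ν • S.P K γ ψ n (τ, x)

/-- `Q₂₀ = -∫_{∂Ωₙ} (x - rₙ) (v̂ · n̄) ρ dσ`. -/
def Q20 (t : ℝ) : E3 :=
  -S.bdryIntegral γ n t fun x ν =>
    (inner ℝ (γ.vel t) ν * ρ K ψ n (t, x)) • (x - S.center K γ ψ n t)

/-- `Q₂₂ = ∫_{∂Ωₙ} (x - rₙ) (n̄ · J) dσ`. -/
def Q22 (t : ℝ) : E3 :=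
  S.bdryIntegral γ n t fun x ν => inner ℝ ν (S.J K γ ψ n (t, x)) • (x - S.center K γ ψ n t)

/-- `Q₂₃ = ∫_{t₀}^t ∫_{∂Ωₙ} (v̂ · n̄) ρ dσ dt' - ∫_{t₀}^t ∫_{∂Ωₙ} n̄ · J dσ dt'`. -/
def Q23 (t : ℝ) : ℝ :=
  (∫ τ in t₀..t, S.bdryIntegral γ n τ fun x ν => inner ℝ (γ.vel τ) ν * ρ K ψ n (τ, x)) -
    ∫ τ in t₀..t, S.bdryIntegral γ n τ fun x ν => inner ℝ ν (S.J K γ ψ n (τ, x))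

/-- `Q₃₀ = ∫_{Ωₙ} (E - E_∞) ρ dx`. -/
def Q30 (t : ℝ) : E3 :=
  ∫ x in γ.ball (S.R n) t, ρ K ψ n (t, x) • (S.E K γ n (t, x) - S.Elim K γ t)

/-- `Q₃₁ = ∫_{Ωₙ} c⁻¹ J × (B - B_∞) dx`. -/
def Q31 (t : ℝ) : E3 :=
  ∫ x in γ.ball (S.R n) t,
    cross (K.c⁻¹ • S.J K γ ψ n (t, x)) (S.B γ n (t, x) - S.Blim γ t)

/-- The solutions `ψₙ` of the localized NLS equations concentrate at the trajectory `γ`, with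
reference time `t₀` and limit charge `ρinf`. -/
structure Concentrates (ρinf : ℝ) : Prop where
  localized : S.IsLocalized K γ
  contDiffOn : ∀ n, ContDiffOn ℝ 2 (ψ n) (S.tube γ n)
  solves : ∀ n, SolvesNLS K N (S.a n) (S.tube γ n) (S.φ n) (S.A n) (ψ n)
  momentum_bounded : ∃ C : ℝ, ∀ n, ∀ t ∈ γ.I, ‖S.totalMomentum K γ ψ n t‖ ≤ C
  charge_bounded : ∃ C c₀ : ℝ, 0 < c₀ ∧ ∃ n₀ : ℕ, ∀ n ≥ n₀, ∀ t ∈ γ.I,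
    c₀ ≤ S.charge K γ ψ n t ∧ S.charge K γ ψ n t ≤ C
  t₀_mem : t₀ ∈ γ.I
  charge_tendsto : Tendsto (fun n => S.charge K γ ψ n t₀) atTop (𝓝 ρinf)
  Q0_tendsto : TendstoUniformlyOn (fun n => S.Q0 K γ N ψ t₀ n) (fun _ => 0) atTop γ.I
  Q01_tendsto : TendstoUniformlyOn (fun n => S.Q01 K γ ψ t₀ n) (fun _ => 0) atTop γ.I
  Q20_tendsto : TendstoUniformlyOn (fun n => S.Q20 K γ ψ n) (fun _ => 0) atTop γ.I
  Q22_tendsto : TendstoUniformlyOn (fun n => S.Q22 K γ ψ n) (fun _ => 0) atTop γ.I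
  Q23_tendsto : TendstoUniformlyOn (fun n => S.Q23 K γ ψ t₀ n) (fun _ => 0) atTop γ.I
  Q3_tendsto : TendstoUniformlyOn
    (fun n t => ∫ τ in t₀..t, (S.Q30 K γ ψ n τ + S.Q31 K γ ψ n τ)) (fun _ => 0) atTop γ.I

end NLSSequence

end NLSPoint

end

/-!
Write `Π(t)` for the momentum in the ball `Ωₙ(t)` and `vₙ` for the velocity of the center. The
theorem follows from two exact balance laws for `ψₙ` on the moving ball and a passage to the limit.

*Local laws.* In terms of the covariant derivatives, the NLS equation gives the continuity equation
`∂ₜ ρ + ∇ · J = 0` (`continuity_equation`) and the momentum balance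
`∂ₜ P^j = ∂ᵢ T^{ij} + ρ E^j + (c⁻¹ J × B)^j` (`momentum_equation`). Both use that covariant
derivatives satisfy the Leibniz rule in gauge invariant products; the second also that they commute
up to the curvature of the connection (`cov_cov_sub`), which is the electromagnetic field. Moreover
`J = (q / m) P`.

*Integration over the moving ball.* The divergence theorem on a closed ball, for functions which are
only `C¹` up to the boundary, is obtained by integrating by parts against the cone
`(ρ - |x|)₊`, passing to polar coordinates and differentiating in `ρ`
(`setIntegral_closedBall_fderivWithin`). In coordinates moving with the trajectory it yields the
transport theorem (`Trajectory.hasDerivWithinAt_integral_ball`). Integrated over `Ωₙ(t)`, the local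
laws say that charge, first moment of the charge and momentum change by the boundary terms, the
total current and the Lorentz force respectively. Hence the total current is `ρ̄ₙ vₙ` up to boundary
terms (`totalCurrent_eq`), the charge converges uniformly to `ρ̄_∞`, and
`(m / q) ρ̄_∞ vₙ(t) = Π(t₀) + ∫_{t₀}^t (ρ̄_∞ E_∞ + ρ̄_∞ vₙ × c⁻¹ B_∞) + o(1)` uniformly in `t`
(`uniformlySmall_motionError`). The fields `E_∞` and `B_∞` are continuous as uniform limits of
`Eₙ` and `Bₙ` on the trajectory.

*The limit.* The charges are positive, so `q > 0`, the charge density is nonnegative and the center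
stays in `Ωₙ(t)`; thus `rₙ → r̂`. The velocities `vₙ` are bounded and, by the integrated equation,
Lipschitz in time up to `o(1)`. Comparing difference quotients of `rₙ` and `r̂` then shows `vₙ → v̂`
pointwise (`tendsto_velocity_of_almost_lipschitz`). Dominated convergence turns the integrated
equation into one for `v̂`, and its time derivative is Newton's law.
-/

noncomputable section

namespace NLSPoint

/-! ### The divergence theorem on a ball -/

/-- A parametric integral over a compact set depends continuously on the parameter. -/
theorem continuousOn_setIntegral_of_isCompact {X Y V : Type*} [TopologicalSpace X]
    [FirstCountableTopology X] [TopologicalSpace Y] [SecondCountableTopology Y] [MeasurableSpace Y]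
    [BorelSpace Y] [NormedAddCommGroup V] [NormedSpace ℝ V] {μ : Measure Y}
    [IsFiniteMeasureOnCompacts μ] {s : Set X} {k : Set Y} (hs : IsCompact s) (hk : IsCompact k)
    (hkm : MeasurableSet k) {f : X → Y → V}
    (hf : ContinuousOn (fun p : X × Y => f p.1 p.2) (s ×ˢ k)) :
    ContinuousOn (fun x => ∫ y in k, f x y ∂μ) s := by
  obtain ⟨C, hC⟩ := (hs.prod hk).exists_bound_of_continuousOn hf
  have hslice : ∀ x ∈ s, ContinuousOn (f x) k := fun x hx =>
    hf.comp (f := fun y => (x, y)) (by fun_prop) fun y hy => ⟨hx, hy⟩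
  refine continuousOn_of_dominated (bound := fun _ => C) ?_ ?_ ?_ ?_
  · exact fun x hx => (hslice x hx).aestronglyMeasurable hkm
  · intro x hx
    filter_upwards [ae_restrict_mem hkm] with y hy using hC (x, y) ⟨hx, hy⟩
  · exact integrableOn_const hk.measure_lt_top.ne
  · filter_upwards [ae_restrict_mem hkm] with y hy
    exact hf.comp (f := fun x => (x, y)) (by fun_prop) fun x hx => ⟨hx, hy⟩

/-- Integration in polar coordinates in `ℝ³`. -/
theorem integral_eq_integral_polar {F : E3 → ℝ} (hF : Integrable F) :
    ∫ x, F x = ∫ r in Ioi (0 : ℝ), r ^ 2 * ∫ ω : Metric.sphere (0 : E3) 1, F (r • (ω : E3))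
      ∂((volume : Measure E3).toSphere) := by
  have hmp := (volume : Measure E3).measurePreserving_homeomorphUnitSphereProd
  have hdim : Module.finrank ℝ E3 - 1 = 2 := by simp
  rw [hdim] at hmp
  set H := homeomorphUnitSphereProd E3
  set G : Metric.sphere (0 : E3) 1 × Ioi (0 : ℝ) → ℝ := fun p => F ((p.2 : ℝ) • (p.1 : E3))
  have hG : ∀ x : ({(0)}ᶜ : Set E3), G (H x) = F x := by
    intro x
    have h0 : (x : E3) ≠ 0 := x.2
    simp [G, H, smul_smul, h0]
  have h1 : Integrable (fun x : ({(0)}ᶜ : Set E3) => F x)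
      (Measure.comap Subtype.val volume) := by
    refine (MeasurableEmbedding.integrable_map_iff
      (MeasurableEmbedding.subtype_coe (measurableSet_singleton (0 : E3)).compl)).1 ?_
    rw [map_comap_subtype_coe (measurableSet_singleton (0 : E3)).compl]
    exact hF.restrict
  have h2 : Integrable G ((volume : Measure E3).toSphere.prod (Measure.volumeIoiPow 2)) := by
    rw [← hmp.integrable_comp_emb H.measurableEmbedding]
    exact h1.congr (Eventually.of_forall fun x => (hG x).symm)
  calc
    ∫ x, F x = ∫ x : ({(0)}ᶜ : Set E3), F x ∂(Measure.comap Subtype.val volume) := by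
      rw [integral_subtype_comap (measurableSet_singleton _).compl fun x => F x,
        restrict_compl_singleton]
    _ = ∫ x : ({(0)}ᶜ : Set E3), G (H x) ∂(Measure.comap Subtype.val volume) := by simp_rw [hG]
    _ = ∫ p, G p ∂((volume : Measure E3).toSphere.prod (Measure.volumeIoiPow 2)) :=
      hmp.integral_comp H.measurableEmbedding G
    _ = ∫ r, ∫ ω, G (ω, r) ∂((volume : Measure E3).toSphere) ∂(Measure.volumeIoiPow 2) :=
      integral_prod_symm _ h2
    _ = _ := by
      simp only [Measure.volumeIoiPow, ENNReal.ofReal]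
      rw [integral_withDensity_eq_integral_smul
        ((measurable_subtype_coe.pow_const _).real_toNNReal),
        integral_subtype_comap measurableSet_Ioi fun a : ℝ => Real.toNNReal (a ^ 2) •
          ∫ ω : Metric.sphere (0 : E3) 1, F (a • (ω : E3)) ∂((volume : Measure E3).toSphere)]
      refine setIntegral_congr_fun measurableSet_Ioi fun x hx => ?_
      simp only [NNReal.smul_def, smul_eq_mul]
      rw [Real.coe_toNNReal _ (by positivity)]

/-- Polar coordinates for the integral of a continuous function over a ball. -/
theorem setIntegral_closedBall_eq_polar {F : E3 → ℝ} {R : ℝ} (hR : 0 ≤ R)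
    (hF : IntegrableOn F (Metric.closedBall 0 R)) :
    ∫ x in Metric.closedBall 0 R, F x = ∫ r in (0 : ℝ)..R, r ^ 2 *
      ∫ ω : Metric.sphere (0 : E3) 1, F (r • (ω : E3)) ∂((volume : Measure E3).toSphere) := by
  rw [← integral_indicator Metric.isClosed_closedBall.measurableSet,
    integral_eq_integral_polar
      ((integrable_indicator_iff Metric.isClosed_closedBall.measurableSet).2 hF),
    intervalIntegral.integral_of_le hR, ← integral_indicator measurableSet_Ioi,
    ← integral_indicator measurableSet_Ioc]
  congr 1
  ext r
  by_cases h0 : 0 < r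
  · have hmem : ∀ ω : Metric.sphere (0 : E3) 1,
        r • (ω : E3) ∈ Metric.closedBall (0 : E3) R ↔ r ≤ R := by
      intro ω
      simp [norm_smul, abs_of_pos h0]
    by_cases hr : r ≤ R
    · rw [indicator_of_mem (by exact h0), indicator_of_mem (by exact ⟨h0, hr⟩)]
      congr 2
      ext ω
      rw [indicator_of_mem ((hmem ω).2 hr)]
    · rw [indicator_of_mem (by exact h0), indicator_of_notMem (by exact fun h => hr h.2)]
      have : ∀ ω : Metric.sphere (0 : E3) 1,
          (Metric.closedBall (0 : E3) R).indicator F (r • (ω : E3)) = 0 := fun ω =>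
        indicator_of_notMem (fun h => hr ((hmem ω).1 h)) _
      simp [this]
  · rw [indicator_of_notMem (by exact h0), indicator_of_notMem (by exact fun h => h0 h.1)]

/-- The cutoff `(ρ - |x|)₊`. -/
def coneCutoff (ρ : ℝ) (x : E3) : ℝ := max (ρ - ‖x‖) 0

theorem lipschitzWith_coneCutoff (ρ : ℝ) : LipschitzWith 1 (coneCutoff ρ) := by
  have h : LipschitzWith 1 fun x : E3 => ρ - ‖x‖ :=
    LipschitzWith.of_dist_le_mul fun x y => by
      have := abs_norm_sub_norm_le y x
      rw [NNReal.coe_one, one_mul, Real.dist_eq, dist_comm, dist_eq_norm]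
      convert this using 2
      ring
  exact h.max_const 0

theorem hasCompactSupport_coneCutoff (ρ : ℝ) : HasCompactSupport (coneCutoff ρ) := by
  refine HasCompactSupport.intro (isCompact_closedBall (0 : E3) ρ) fun x hx => ?_
  have : ρ < ‖x‖ := by simpa using hx
  exact max_eq_right (by linarith)

theorem lineDeriv_coneCutoff_of_lt {ρ : ℝ} {x : E3} (hx0 : x ≠ 0) (hx : ‖x‖ < ρ) (v : E3) :
    lineDeriv ℝ (coneCutoff ρ) x (-v) = inner ℝ v (‖x‖⁻¹ • x) := by
  have hev : coneCutoff ρ =ᶠ[𝓝 x] fun y => ρ - ‖y‖ := by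
    filter_upwards [(isOpen_lt continuous_norm continuous_const).mem_nhds hx] with y hy
    exact max_eq_left (sub_nonneg.2 (le_of_lt hy))
  rw [hev.lineDeriv_eq]
  have h2 : HasFDerivAt (fun y : E3 => ‖y‖) (‖x‖⁻¹ • innerSL ℝ x) x := by
    have := ((hasStrictFDerivAt_norm_sq x).hasFDerivAt).sqrt (by positivity)
    refine (this.congr_of_eventuallyEq ?_).congr_fderiv ?_
    · exact Eventually.of_forall fun y => (Real.sqrt_sq (norm_nonneg y)).symm
    · rw [Real.sqrt_sq (norm_nonneg x)]
      ext w
      simp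
      field_simp
  have h3 := ((h2.const_sub ρ).hasLineDerivAt (-v)).lineDeriv
  rw [h3]
  simp [inner_smul_right, real_inner_comm]

theorem lineDeriv_coneCutoff_of_gt {ρ : ℝ} {x : E3} (hx : ρ < ‖x‖) (v : E3) :
    lineDeriv ℝ (coneCutoff ρ) x v = 0 := by
  have hev : coneCutoff ρ =ᶠ[𝓝 x] fun _ => 0 := by
    filter_upwards [(isOpen_lt continuous_const continuous_norm).mem_nhds hx] with y hy
    exact max_eq_right (sub_nonpos.2 (le_of_lt hy))
  rw [hev.lineDeriv_eq]
  simp [lineDeriv]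

/-- Integrating a directional derivative by parts against the cutoff `(ρ - |x|)₊`. -/
theorem setIntegral_mul_cone_eq {f : E3 → ℝ} {f' : E3 → E3 →L[ℝ] ℝ} {R ρ : ℝ} (hρR : ρ ≤ R)
    (hf : ∀ x ∈ Metric.closedBall (0 : E3) R,
      HasFDerivWithinAt f (f' x) (Metric.closedBall 0 R) x)
    (hf' : ContinuousOn f' (Metric.closedBall 0 R)) (v : E3) :
    ∫ x in Metric.closedBall 0 ρ, f' x v * (ρ - ‖x‖) =
      ∫ x in Metric.closedBall 0 ρ, inner ℝ v (‖x‖⁻¹ • x) * f x := by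
  obtain ⟨C, hC⟩ := (isCompact_closedBall (0 : E3) R).exists_bound_of_continuousOn hf'
  have hlip : LipschitzOnWith C.toNNReal f (Metric.closedBall 0 R) :=
    (convex_closedBall _ _).lipschitzOnWith_of_nnnorm_hasFDerivWithin_le hf fun x hx => by
      rw [← NNReal.coe_le_coe, coe_nnnorm]
      exact (hC x hx).trans (Real.le_coe_toNNReal C)
  -- integration by parts for Lipschitz functions needs `f` extended to all of space
  obtain ⟨g, hg, hfg⟩ := hlip.extend_real
  have key := LipschitzWith.integral_lineDeriv_mul_eq (μ := (volume : Measure E3)) hg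
    (lipschitzWith_coneCutoff ρ) (hasCompactSupport_coneCutoff ρ) v
  have hsph : ∀ᵐ x : E3, ‖x‖ ≠ ρ := by
    have : (volume : Measure E3) (Metric.sphere 0 ρ) = 0 := Measure.addHaar_sphere _ _ _
    filter_upwards [compl_mem_ae_iff.2 this] with x hx
    simpa using hx
  have h0 : ∀ᵐ x : E3, x ≠ 0 := by
    filter_upwards [compl_mem_ae_iff.2 (measure_singleton (0 : E3))] with x hx
    simpa using hx
  rw [← integral_indicator Metric.isClosed_closedBall.measurableSet,
    ← integral_indicator Metric.isClosed_closedBall.measurableSet]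
  convert key using 1
  · refine integral_congr_ae ?_
    filter_upwards [hsph] with x hx
    by_cases hlt : ‖x‖ < ρ
    · have hmem : x ∈ Metric.closedBall (0 : E3) ρ := by simpa using hlt.le
      have hnh : Metric.closedBall (0 : E3) R ∈ 𝓝 x :=
        Filter.mem_of_superset (Metric.isOpen_ball.mem_nhds
          (show x ∈ Metric.ball (0 : E3) R by simpa using hlt.trans_le hρR))
          Metric.ball_subset_closedBall
      have hd : HasFDerivAt g (f' x) x :=
        ((hf x (mem_of_mem_nhds hnh)).hasFDerivAt hnh).congr_of_eventuallyEq
          (Filter.mem_of_superset hnh fun y hy => (hfg hy).symm)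
      rw [indicator_of_mem hmem, (hd.hasLineDerivAt v).lineDeriv, coneCutoff,
        max_eq_left (by linarith)]
    · have hgt : ρ < ‖x‖ := lt_of_le_of_ne (not_lt.1 hlt) (Ne.symm hx)
      rw [indicator_of_notMem (by simpa using hgt), coneCutoff, max_eq_right (by linarith),
        mul_zero]
  · refine integral_congr_ae ?_
    filter_upwards [hsph, h0] with x hx hx0
    by_cases hlt : ‖x‖ < ρ
    · have hmem : x ∈ Metric.closedBall (0 : E3) ρ := by simpa using hlt.le
      rw [indicator_of_mem hmem, lineDeriv_coneCutoff_of_lt hx0 hlt,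
        hfg (Metric.closedBall_subset_closedBall hρR hmem)]
    · have hgt : ρ < ‖x‖ := lt_of_le_of_ne (not_lt.1 hlt) (Ne.symm hx)
      rw [indicator_of_notMem (by simpa using hgt), lineDeriv_coneCutoff_of_gt hgt, zero_mul]

/-- If `∫₀^ρ (ρ - r) a r dr = ∫₀^ρ b r dr` for all `ρ ∈ [0, R]`, then `∫₀^R a = b R`: both sides of
the hypothesis are differentiated with respect to `ρ` at `ρ = R`. -/
theorem integral_eq_of_integral_sub_mul_eq {a b : ℝ → ℝ} {R : ℝ} (hR : 0 < R)
    (ha : ContinuousOn a (Icc 0 R)) (hb : ContinuousOn b (Icc 0 R))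
    (h : ∀ ρ ∈ Icc 0 R, ∫ r in (0 : ℝ)..ρ, (ρ - r) * a r = ∫ r in (0 : ℝ)..ρ, b r) :
    ∫ r in (0 : ℝ)..R, a r = b R := by
  have hmem : R ∈ Icc 0 R := ⟨hR.le, le_rfl⟩
  have hfact : Fact (R ∈ Icc 0 R) := ⟨hmem⟩
  have hderiv : ∀ {g : ℝ → ℝ}, ContinuousOn g (Icc 0 R) →
      HasDerivWithinAt (fun ρ => ∫ r in (0 : ℝ)..ρ, g r) (g R) (Icc 0 R) R := fun hg =>
    intervalIntegral.integral_hasDerivWithinAt_right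
      (hg.intervalIntegrable_of_Icc hR.le)
      (hg.stronglyMeasurableAtFilter_nhdsWithin measurableSet_Icc R) (hg R hmem)
  have hra : ContinuousOn (fun r => r * a r) (Icc 0 R) := continuousOn_id.mul ha
  have h1 : HasDerivWithinAt
      (fun ρ => ρ * (∫ r in (0 : ℝ)..ρ, a r) - ∫ r in (0 : ℝ)..ρ, r * a r)
      (1 * (∫ r in (0 : ℝ)..R, a r) + R * a R - R * a R) (Icc 0 R) R :=
    ((hasDerivWithinAt_id R _).mul (hderiv ha)).sub (hderiv hra)
  have h2 := h1.congr_of_mem (f₁ := fun ρ => ∫ r in (0 : ℝ)..ρ, b r) (fun ρ hρ => ?_) hmem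
  · have := (uniqueDiffOn_Icc hR R hmem).eq_deriv _ h2 (hderiv hb)
    linarith
  · have hsub : Icc 0 ρ ⊆ Icc 0 R := Icc_subset_Icc le_rfl hρ.2
    rw [← h ρ hρ, ← intervalIntegral.integral_const_mul, ← intervalIntegral.integral_sub]
    · exact intervalIntegral.integral_congr fun r _ => by ring
    · exact (((ha.mono hsub).intervalIntegrable_of_Icc hρ.1)).const_mul _
    · exact (hra.mono hsub).intervalIntegrable_of_Icc hρ.1

theorem continuousOn_integral_sphere {F : E3 → ℝ} {R : ℝ}
    (hF : ContinuousOn F (Metric.closedBall 0 R)) (w : E3 → ℝ) (hw : Continuous w) :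
    ContinuousOn (fun r : ℝ => ∫ ω : Metric.sphere (0 : E3) 1, w ω * F (r • (ω : E3))
      ∂((volume : Measure E3).toSphere)) (Icc 0 R) := by
  have := continuousOn_setIntegral_of_isCompact (μ := (volume : Measure E3).toSphere)
    (isCompact_Icc (a := (0 : ℝ)) (b := R)) (isCompact_univ (X := Metric.sphere (0 : E3) 1))
    MeasurableSet.univ (f := fun r ω => w ω * F (r • (ω : E3))) ?_
  · simpa using this
  · refine ContinuousOn.mul (by fun_prop) (hF.comp (by fun_prop) ?_)
    rintro ⟨r, ω⟩ ⟨hr, -⟩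
    simpa [norm_smul, abs_of_nonneg hr.1] using hr.2

/-- The divergence theorem on a ball, for one directional derivative of a function which is
continuously differentiable up to the boundary. In polar coordinates, integration by parts against
the cutoffs `(ρ - |x|)₊` gives this identity integrated over the radii `ρ ≤ R`. -/
theorem setIntegral_closedBall_fderivWithin {f : E3 → ℝ} {f' : E3 → E3 →L[ℝ] ℝ} {R : ℝ}
    (hR : 0 < R)
    (hf : ∀ x ∈ Metric.closedBall (0 : E3) R,
      HasFDerivWithinAt f (f' x) (Metric.closedBall 0 R) x)
    (hf' : ContinuousOn f' (Metric.closedBall 0 R)) (v : E3) :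
    ∫ x in Metric.closedBall 0 R, f' x v = surfaceIntegral 0 R fun x ν => inner ℝ v ν * f x := by
  have hfc : ContinuousOn f (Metric.closedBall 0 R) := fun x hx => (hf x hx).continuousWithinAt
  have hf'v : ContinuousOn (fun x => f' x v) (Metric.closedBall 0 R) :=
    hf'.clm_apply continuousOn_const
  set σ := (volume : Measure E3).toSphere
  set a : ℝ → ℝ := fun r => r ^ 2 * ∫ ω : Metric.sphere (0 : E3) 1, f' (r • (ω : E3)) v ∂σ
  set b : ℝ → ℝ := fun r =>
    r ^ 2 * ∫ ω : Metric.sphere (0 : E3) 1, inner ℝ v (ω : E3) * f (r • (ω : E3)) ∂σ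
  have ha : ContinuousOn a (Icc 0 R) := by
    refine (continuousOn_id.pow 2).mul ?_
    simpa using continuousOn_integral_sphere hf'v (fun _ => 1) continuous_const
  have hb : ContinuousOn b (Icc 0 R) :=
    (continuousOn_id.pow 2).mul
      (continuousOn_integral_sphere hfc (fun ω => inner ℝ v ω) (by fun_prop))
  have hpolar := setIntegral_closedBall_eq_polar hR.le
    (hf'v.integrableOn_compact (isCompact_closedBall _ _))
  rw [hpolar]
  refine (integral_eq_of_integral_sub_mul_eq hR ha hb fun ρ hρ => ?_).trans ?_
  · have hsub : Metric.closedBall (0 : E3) ρ ⊆ Metric.closedBall 0 R :=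
      Metric.closedBall_subset_closedBall hρ.2
    have key := setIntegral_mul_cone_eq hρ.2 hf hf' v
    have hint1 : IntegrableOn (fun x => f' x v * (ρ - ‖x‖)) (Metric.closedBall 0 ρ) :=
      ((hf'v.mono hsub).mul (by fun_prop)).integrableOn_compact (isCompact_closedBall _ _)
    have hint2 : IntegrableOn (fun x => inner ℝ v (‖x‖⁻¹ • x) * f x) (Metric.closedBall 0 ρ) := by
      have hfi : IntegrableOn f (Metric.closedBall 0 ρ) :=
        (hfc.mono hsub).integrableOn_compact (isCompact_closedBall _ _)
      refine Integrable.bdd_mul (c := ‖v‖) hfi ?_ ?_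
      · exact (Measurable.inner measurable_const
          (measurable_norm.inv.smul measurable_id)).aestronglyMeasurable
      · refine Eventually.of_forall fun x => (norm_inner_le_norm _ _).trans ?_
        refine mul_le_of_le_one_right (norm_nonneg v) ?_
        rw [norm_smul, norm_inv, norm_norm]
        exact inv_mul_le_one
    rw [setIntegral_closedBall_eq_polar hρ.1 hint1,
      setIntegral_closedBall_eq_polar hρ.1 hint2] at key
    refine Eq.trans ?_ (key.trans ?_)
    · refine intervalIntegral.integral_congr_ae (Eventually.of_forall fun r hr => ?_)
      rw [uIoc_of_le hρ.1] at hr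
      simp only [a, norm_smul, norm_eq_of_mem_sphere, mul_one, Real.norm_eq_abs,
        abs_of_pos hr.1, integral_mul_const]
      ring
    · refine intervalIntegral.integral_congr_ae (Eventually.of_forall fun r hr => ?_)
      rw [uIoc_of_le hρ.1] at hr
      have h1 : ∀ ω : Metric.sphere (0 : E3) 1, ‖r • (ω : E3)‖⁻¹ • r • (ω : E3) = ω := fun ω => by
        rw [norm_smul, norm_eq_of_mem_sphere, mul_one, Real.norm_eq_abs, abs_of_pos hr.1,
          inv_smul_smul₀ hr.1.ne']
      simp only [b, h1, σ]
  · simp [b, surfaceIntegral, σ]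

/-! ### Tubes around a trajectory -/

namespace Trajectory

variable (γ : Trajectory) {R : ℝ}

theorem uniqueDiffOn_I : UniqueDiffOn ℝ γ.I := uniqueDiffOn_Icc γ.lt

theorem continuousOn_pos : ContinuousOn γ.pos γ.I := γ.contDiffOn.continuousOn

theorem hasDerivWithinAt_pos {t : ℝ} (ht : t ∈ γ.I) :
    HasDerivWithinAt γ.pos (γ.vel t) γ.I t :=
  (γ.contDiffOn.differentiableOn (by norm_num) t ht).hasDerivWithinAt

theorem continuousOn_vel : ContinuousOn γ.vel γ.I :=
  γ.contDiffOn.continuousOn_derivWithin γ.uniqueDiffOn_I (by norm_num)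

/-- The coordinates `(t, y) ↦ (t, r̂(t) + y)` moving with the trajectory. -/
def shift (p : ST) : ST := (p.1, γ.pos p.1 + p.2)

theorem measurableSet_ball (t : ℝ) : MeasurableSet (γ.ball R t) :=
  Metric.isClosed_closedBall.measurableSet

theorem tube_eq_image : γ.tube R = γ.shift '' (γ.I ×ˢ Metric.closedBall 0 R) := by
  ext ⟨t, x⟩
  constructor
  · rintro ⟨ht, hx⟩
    refine ⟨(t, x - γ.pos t), ⟨ht, ?_⟩, ?_⟩
    · simpa [ball, dist_eq_norm] using hx
    · simp [shift]
  · rintro ⟨⟨s, y⟩, ⟨hs, hy⟩, h⟩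
    simp only [shift, Prod.mk.injEq] at h
    obtain ⟨rfl, rfl⟩ := h
    exact ⟨hs, by simpa [ball, dist_eq_norm] using hy⟩

theorem shift_mem_tube {t : ℝ} (ht : t ∈ γ.I) {y : E3} (hy : y ∈ Metric.closedBall (0 : E3) R) :
    γ.shift (t, y) ∈ γ.tube R := γ.tube_eq_image ▸ mem_image_of_mem _ ⟨ht, hy⟩

theorem continuousOn_shift : ContinuousOn γ.shift (γ.I ×ˢ univ) :=
  continuousOn_fst.prodMk
    ((γ.continuousOn_pos.comp continuousOn_fst fun _ hp => hp.1).add continuousOn_snd)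

theorem uniqueDiffOn_tube (hR : 0 < R) : UniqueDiffOn ℝ (γ.tube R) := by
  rw [tube_eq_image]
  rintro _ ⟨⟨t, y⟩, ⟨ht, hy⟩, rfl⟩
  have hu : UniqueDiffOn ℝ (γ.I ×ˢ Metric.closedBall (0 : E3) R) :=
    γ.uniqueDiffOn_I.prod (uniqueDiffOn_convex (convex_closedBall _ _)
      ((Metric.nonempty_ball.2 hR).mono
        (interior_maximal Metric.ball_subset_closedBall Metric.isOpen_ball)))
  have hpos : HasFDerivWithinAt (fun p : ST => γ.pos p.1)
      ((ContinuousLinearMap.toSpanSingleton ℝ (γ.vel t)).comp (ContinuousLinearMap.fst ℝ ℝ E3))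
      (γ.I ×ˢ Metric.closedBall (0 : E3) R) (t, y) :=
    HasFDerivWithinAt.comp (t, y) (γ.hasDerivWithinAt_pos ht).hasFDerivWithinAt
      hasFDerivWithinAt_fst fun p hp => hp.1
  have h : HasFDerivWithinAt γ.shift _ (γ.I ×ˢ Metric.closedBall (0 : E3) R) (t, y) :=
    hasFDerivWithinAt_fst.prodMk (hpos.add hasFDerivWithinAt_snd)
  refine h.uniqueDiffWithinAt (hu _ ⟨ht, hy⟩) (Function.Surjective.denseRange ?_)
  rintro ⟨s, x⟩
  exact ⟨(s, x - s • γ.vel t), by simp⟩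

/-- Second derivatives within the tube are symmetric up to its boundary because of this. -/
theorem tube_subset_closure_interior (hR : 0 < R) : γ.tube R ⊆ closure (interior (γ.tube R)) := by
  have hopen : IsOpen {p : ST | p.1 ∈ Ioo γ.Tm γ.Tp ∧ dist p.2 (γ.pos p.1) < R} := by
    have hc : ContinuousOn (fun p : ST => dist p.2 (γ.pos p.1)) (Ioo γ.Tm γ.Tp ×ˢ univ) :=
      continuous_dist.comp_continuousOn (continuousOn_snd.prodMk
        ((γ.continuousOn_pos.mono Ioo_subset_Icc_self).comp continuousOn_fst fun _ hp => hp.1))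
    have := hc.isOpen_inter_preimage (isOpen_Ioo.prod isOpen_univ) (isOpen_Iio (a := R))
    convert this using 1
    ext p
    simp
  have hsub : γ.shift '' (Ioo γ.Tm γ.Tp ×ˢ Metric.ball 0 R) ⊆ interior (γ.tube R) := by
    refine Subset.trans ?_ (interior_maximal (fun p hp => ⟨Ioo_subset_Icc_self hp.1, ?_⟩) hopen)
    · rintro _ ⟨⟨t, y⟩, ⟨ht, hy⟩, rfl⟩
      exact ⟨ht, by simpa [shift, dist_eq_norm] using hy⟩
    · exact hp.2.le
  rw [tube_eq_image]
  rintro _ ⟨⟨t, y⟩, ⟨ht, hy⟩, rfl⟩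
  refine closure_mono ?_ (((γ.continuousOn_shift (t, y) ⟨ht, trivial⟩).mono ?_).mem_closure_image
    (s := Ioo γ.Tm γ.Tp ×ˢ Metric.ball 0 R) ?_)
  · rw [← tube_eq_image]; exact hsub
  · exact prod_mono Ioo_subset_Icc_self (subset_univ _)
  · rw [closure_prod_eq, closure_Ioo γ.lt.ne, closure_ball _ hR.ne']
    exact ⟨ht, hy⟩

theorem continuousOn_slice {V : Type*} [TopologicalSpace V] {f : ST → V}
    (hf : ContinuousOn f (γ.tube R)) {t : ℝ} (ht : t ∈ γ.I) :
    ContinuousOn (fun x => f (t, x)) (γ.ball R t) :=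
  hf.comp (by fun_prop) fun _ hx => ⟨ht, hx⟩

theorem integrableOn_slice {V : Type*} [NormedAddCommGroup V] {f : ST → V}
    (hf : ContinuousOn f (γ.tube R)) {t : ℝ} (ht : t ∈ γ.I) :
    IntegrableOn (fun x => f (t, x)) (γ.ball R t) :=
  (γ.continuousOn_slice hf ht).integrableOn_compact (isCompact_closedBall _ _)

variable {V : Type*} [NormedAddCommGroup V] [NormedSpace ℝ V]

theorem setIntegral_ball_eq_shift (f : ST → V) (t : ℝ) :
    ∫ x in γ.ball R t, f (t, x) = ∫ y in Metric.closedBall (0 : E3) R, f (γ.shift (t, y)) := by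
  have h := (measurePreserving_add_left (volume : Measure E3) (γ.pos t)).setIntegral_preimage_emb
    (MeasurableEquiv.addLeft (γ.pos t)).measurableEmbedding (fun x => f (t, x)) (γ.ball R t)
  rw [← h]
  congr 2
  ext y
  simp [ball, dist_eq_norm]

theorem continuousOn_integral_ball {f : ST → V} (hf : ContinuousOn f (γ.tube R)) :
    ContinuousOn (fun t => ∫ x in γ.ball R t, f (t, x)) γ.I := by
  simp_rw [setIntegral_ball_eq_shift]
  refine continuousOn_setIntegral_of_isCompact isCompact_Icc (isCompact_closedBall _ _)
    Metric.isClosed_closedBall.measurableSet (f := fun t y => f (γ.shift (t, y))) ?_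
  exact hf.comp (γ.continuousOn_shift.mono (prod_mono le_rfl (subset_univ _)))
    fun p hp => γ.shift_mem_tube hp.1 hp.2

theorem sphere_mem_tube (hR : 0 < R) {t : ℝ} (ht : t ∈ γ.I) (ω : Metric.sphere (0 : E3) 1) :
    (t, γ.pos t + R • (ω : E3)) ∈ γ.tube R :=
  ⟨ht, by simp [ball, dist_eq_norm, norm_smul, abs_of_pos hR]⟩

theorem continuousOn_sphere_param {V : Type*} [TopologicalSpace V] (hR : 0 < R) {f : ST → V}
    (hf : ContinuousOn f (γ.tube R)) :
    ContinuousOn (fun p : ℝ × Metric.sphere (0 : E3) 1 => f (p.1, γ.pos p.1 + R • (p.2 : E3)))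
      (γ.I ×ˢ univ) := by
  refine hf.comp ?_ fun p hp => γ.sphere_mem_tube hR hp.1 p.2
  exact continuousOn_fst.prodMk
    ((γ.continuousOn_pos.comp continuousOn_fst fun _ hp => hp.1).add (by fun_prop))

theorem continuousOn_surfaceIntegral {f : ℝ → E3 → E3 → V}
    (hf : ContinuousOn (fun p : ℝ × Metric.sphere (0 : E3) 1 =>
      f p.1 (γ.pos p.1 + R • (p.2 : E3)) p.2) (γ.I ×ˢ univ)) :
    ContinuousOn (fun t => surfaceIntegral (γ.pos t) R (f t)) γ.I := by
  refine ContinuousOn.const_smul ?_ _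
  have := continuousOn_setIntegral_of_isCompact (μ := (volume : Measure E3).toSphere)
    (isCompact_Icc (a := γ.Tm) (b := γ.Tp)) (isCompact_univ (X := Metric.sphere (0 : E3) 1))
    MeasurableSet.univ (f := fun t ω => f t (γ.pos t + R • (ω : E3)) ω) hf
  simp only [Measure.restrict_univ] at this
  exact this

end Trajectory

/-! ### Transport of integrals over a moving ball -/

theorem hasFDerivWithinAt_of_contDiffOn_one {E F : Type*} [NormedAddCommGroup E] [NormedSpace ℝ E]
    [NormedAddCommGroup F] [NormedSpace ℝ F] {f : E → F} {s : Set E} (hf : ContDiffOn ℝ 1 f s)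
    {x : E} (hx : x ∈ s) : HasFDerivWithinAt f (fderivWithin ℝ f s x) s x :=
  (hf.differentiableOn one_ne_zero x hx).hasFDerivWithinAt

namespace Trajectory

variable (γ : Trajectory) {R : ℝ} {V : Type*} [NormedAddCommGroup V] [NormedSpace ℝ V]

/-- The divergence theorem on the balls of a tube, for one spatial derivative. -/
theorem setIntegral_fderivWithin_space (hR : 0 < R) {f : ST → ℝ}
    (hf : ContDiffOn ℝ 1 f (γ.tube R)) {t : ℝ} (ht : t ∈ γ.I) (v : E3) :
    ∫ x in γ.ball R t, fderivWithin ℝ f (γ.tube R) (t, x) (0, v) =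
      surfaceIntegral (γ.pos t) R fun x ν => inner ℝ v ν * f (t, x) := by
  rw [γ.setIntegral_ball_eq_shift fun p => fderivWithin ℝ f (γ.tube R) p (0, v)]
  have hmaps : MapsTo (fun y => γ.shift (t, y)) (Metric.closedBall 0 R) (γ.tube R) :=
    fun y hy => γ.shift_mem_tube ht hy
  have hder : ∀ y : E3, HasFDerivWithinAt (fun y => γ.shift (t, y))
      (ContinuousLinearMap.inr ℝ ℝ E3) (Metric.closedBall 0 R) y := fun y =>
    (hasFDerivWithinAt_const t y _).prodMk ((hasFDerivWithinAt_id y _).const_add (γ.pos t))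
  have hc := hf.continuousOn_fderivWithin (γ.uniqueDiffOn_tube hR) le_rfl
  have := setIntegral_closedBall_fderivWithin hR (f := fun y => f (γ.shift (t, y)))
    (f' := fun y => (fderivWithin ℝ f (γ.tube R) (γ.shift (t, y))).comp
      (ContinuousLinearMap.inr ℝ ℝ E3))
    (fun y hy => (hasFDerivWithinAt_of_contDiffOn_one hf (hmaps hy)).comp y (hder y) hmaps)
    ((hc.comp (fun y hy => (hder y).continuousWithinAt) hmaps).clm_comp continuousOn_const) v
  simpa [surfaceIntegral, shift] using this

variable [CompleteSpace V]

/-- Transport theorem with the derivative following the ball: in the moving coordinates the domain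
of integration is fixed, and the material derivative `∂ₜ + v̂ · ∇` is integrated. -/
theorem hasDerivWithinAt_integral_ball_aux (hR : 0 < R) {f : ST → V}
    (hf : ContDiffOn ℝ 1 f (γ.tube R)) {t : ℝ} (ht : t ∈ γ.I) :
    HasDerivWithinAt (fun t => ∫ x in γ.ball R t, f (t, x))
      (∫ x in γ.ball R t, fderivWithin ℝ f (γ.tube R) (t, x) (1, γ.vel t)) γ.I t := by
  set g : ST → V := fun p => fderivWithin ℝ f (γ.tube R) p (1, γ.vel p.1)
  have hg : ContinuousOn g (γ.tube R) :=
    (hf.continuousOn_fderivWithin (γ.uniqueDiffOn_tube hR) le_rfl).clm_apply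
      (continuousOn_const.prodMk (γ.continuousOn_vel.comp continuousOn_fst fun p hp => hp.1))
  have hgs : ContinuousOn (fun p => g (γ.shift p)) (γ.I ×ˢ Metric.closedBall 0 R) :=
    hg.comp (γ.continuousOn_shift.mono (prod_mono le_rfl (subset_univ _)))
      fun p hp => γ.shift_mem_tube hp.1 hp.2
  have hh := γ.continuousOn_integral_ball hg
  have hder : ∀ y ∈ Metric.closedBall (0 : E3) R, ∀ s ∈ γ.I,
      HasDerivWithinAt (fun s => f (γ.shift (s, y))) (g (γ.shift (s, y))) γ.I s := by
    intro y hy s hs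
    have h1 : HasDerivWithinAt (fun s => γ.shift (s, y)) (1, γ.vel s) γ.I s :=
      (hasDerivWithinAt_id s _).prodMk ((γ.hasDerivWithinAt_pos hs).add_const y)
    exact (hasFDerivWithinAt_of_contDiffOn_one hf (γ.shift_mem_tube hs hy)).comp_hasDerivWithinAt
      s h1 fun s hs => γ.shift_mem_tube hs hy
  have hTm : γ.Tm ∈ γ.I := ⟨le_rfl, γ.lt.le⟩
  -- the integral is a primitive, by Fubini and the fundamental theorem of calculus along each
  -- path `s ↦ (s, r̂(s) + y)`; this also covers the one-sided derivatives at the end points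
  have hprim : ∀ s ∈ γ.I, ∫ x in γ.ball R s, f (s, x) = (∫ x in γ.ball R γ.Tm, f (γ.Tm, x)) +
      ∫ τ in γ.Tm..s, ∫ x in γ.ball R τ, g (τ, x) := by
    intro s hs
    have hsub : Icc γ.Tm s ⊆ γ.I := Icc_subset_Icc le_rfl hs.2
    have hint : ∀ r ∈ γ.I, IntegrableOn (fun y => f (γ.shift (r, y))) (Metric.closedBall 0 R) :=
      fun r hr => ContinuousOn.integrableOn_compact (isCompact_closedBall _ _)
        (hf.continuousOn.comp (γ.continuousOn_shift.comp (by fun_prop) fun y _ => ⟨hr, trivial⟩)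
          fun y hy => γ.shift_mem_tube hr hy)
    have hftc : ∀ y ∈ Metric.closedBall (0 : E3) R,
        ∫ τ in γ.Tm..s, g (γ.shift (τ, y)) = f (γ.shift (s, y)) - f (γ.shift (γ.Tm, y)) := by
      intro y hy
      refine intervalIntegral.integral_eq_sub_of_hasDerivAt_of_le hs.1
        (f := fun τ => f (γ.shift (τ, y)))
        (fun τ hτ => ((hder y hy τ (hsub hτ)).continuousWithinAt).mono hsub) (fun τ hτ => ?_) ?_
      · exact (hder y hy τ (hsub (Ioo_subset_Icc_self hτ))).hasDerivAt
          (Icc_mem_nhds hτ.1 (hτ.2.trans_le hs.2))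
      · exact ContinuousOn.intervalIntegrable_of_Icc hs.1
          (hgs.comp (f := fun τ => (τ, y)) (by fun_prop) fun τ hτ => ⟨hsub hτ, hy⟩)
    have hswap : ∫ y in Metric.closedBall (0 : E3) R, ∫ τ in γ.Tm..s, g (γ.shift (τ, y)) =
        ∫ τ in γ.Tm..s, ∫ y in Metric.closedBall (0 : E3) R, g (γ.shift (τ, y)) := by
      simp_rw [intervalIntegral.integral_of_le hs.1]
      refine integral_integral_swap ?_
      rw [Measure.prod_restrict]
      have : IntegrableOn (Function.uncurry fun (y : E3) (τ : ℝ) => g (γ.shift (τ, y)))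
          (Metric.closedBall 0 R ×ˢ Icc γ.Tm s) :=
        ContinuousOn.integrableOn_compact ((isCompact_closedBall _ _).prod isCompact_Icc)
          (hgs.comp continuous_swap.continuousOn fun p hp => ⟨hsub hp.2, hp.1⟩)
      exact this.mono_set (prod_mono le_rfl Ioc_subset_Icc_self)
    simp_rw [setIntegral_ball_eq_shift]
    rw [← hswap, setIntegral_congr_fun Metric.isClosed_closedBall.measurableSet hftc,
      integral_sub (hint s hs) (hint _ hTm)]
    abel
  have : Fact (t ∈ Icc γ.Tm γ.Tp) := ⟨ht⟩
  have hft : HasDerivWithinAt (fun s => ∫ τ in γ.Tm..s, ∫ x in γ.ball R τ, g (τ, x))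
      (∫ x in γ.ball R t, g (t, x)) (Icc γ.Tm γ.Tp) t :=
    intervalIntegral.integral_hasDerivWithinAt_right
      ((hh.mono (Icc_subset_Icc le_rfl ht.2)).intervalIntegrable_of_Icc ht.1)
      (hh.stronglyMeasurableAtFilter_nhdsWithin measurableSet_Icc t) (hh t ht)
  exact (hft.const_add _).congr_of_mem hprim ht

/-- Transport theorem: the derivative of the integral over the moving ball. -/
theorem hasDerivWithinAt_integral_ball (hR : 0 < R) {f : ST → ℝ}
    (hf : ContDiffOn ℝ 1 f (γ.tube R)) {t : ℝ} (ht : t ∈ γ.I) :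
    HasDerivWithinAt (fun t => ∫ x in γ.ball R t, f (t, x))
      ((∫ x in γ.ball R t, dt (γ.tube R) f (t, x)) +
        surfaceIntegral (γ.pos t) R fun x ν => inner ℝ (γ.vel t) ν * f (t, x)) γ.I t := by
  refine (γ.hasDerivWithinAt_integral_ball_aux hR hf ht).congr_deriv ?_
  have hc := hf.continuousOn_fderivWithin (γ.uniqueDiffOn_tube hR) le_rfl
  rw [← γ.setIntegral_fderivWithin_space hR hf ht, ← integral_add]
  · congr 1
    ext x
    rw [dt, ← map_add]
    simp
  · exact γ.integrableOn_slice (f := fun p => fderivWithin ℝ f (γ.tube R) p (1, 0))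
      (hc.clm_apply continuousOn_const) ht
  · exact γ.integrableOn_slice (f := fun p => fderivWithin ℝ f (γ.tube R) p (0, γ.vel t))
      (hc.clm_apply continuousOn_const) ht

end Trajectory

/-! ### Covariant derivatives -/

section Covariant

variable {D : Set ST} {p : ST}

/-- The covariant derivative `∂_w f + i α f` in the space-time direction `w`. -/
def cov (D : Set ST) (α : ST → ℝ) (w : ST) (f : ST → ℂ) (p : ST) : ℂ :=
  fderivWithin ℝ f D p w + Complex.I * α p * f p

/-- Leibniz rule: the connection terms cancel in gauge invariant products. -/
theorem fderivWithin_star_mul (hu : UniqueDiffWithinAt ℝ D p) {f g : ST → ℂ}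
    (hf : DifferentiableWithinAt ℝ f D p) (hg : DifferentiableWithinAt ℝ g D p)
    (α : ST → ℝ) (w : ST) :
    fderivWithin ℝ (fun p => star (f p) * g p) D p w =
      star (cov D α w f p) * g p + star (f p) * cov D α w g p := by
  have h := (hf.hasFDerivWithinAt.star).mul hg.hasFDerivWithinAt
  have h2 := h.fderivWithin hu
  have h3 : fderivWithin ℝ (fun p => star (f p) * g p) D p w = _ := congrArg (fun L => L w) h2
  rw [h3]
  simp [cov]
  ring

theorem differentiableWithinAt_star_mul {f g : ST → ℂ}
    (hf : DifferentiableWithinAt ℝ f D p) (hg : DifferentiableWithinAt ℝ g D p) :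
    DifferentiableWithinAt ℝ (fun p => star (f p) * g p) D p :=
  ((hf.hasFDerivWithinAt.star).mul hg.hasFDerivWithinAt).differentiableWithinAt

theorem hasFDerivWithinAt_re_star_mul {f g : ST → ℂ}
    (hf : DifferentiableWithinAt ℝ f D p) (hg : DifferentiableWithinAt ℝ g D p) :
    HasFDerivWithinAt (fun p => (star (f p) * g p).re)
      (Complex.reCLM.comp (fderivWithin ℝ (fun p => star (f p) * g p) D p)) D p :=
  Complex.reCLM.hasFDerivAt.comp_hasFDerivWithinAt p
    (differentiableWithinAt_star_mul hf hg).hasFDerivWithinAt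

theorem hasFDerivWithinAt_im_star_mul {f g : ST → ℂ}
    (hf : DifferentiableWithinAt ℝ f D p) (hg : DifferentiableWithinAt ℝ g D p) :
    HasFDerivWithinAt (fun p => (star (f p) * g p).im)
      (Complex.imCLM.comp (fderivWithin ℝ (fun p => star (f p) * g p) D p)) D p :=
  Complex.imCLM.hasFDerivAt.comp_hasFDerivWithinAt p
    (differentiableWithinAt_star_mul hf hg).hasFDerivWithinAt

theorem contDiffOn_fderivWithin_apply {V : Type*} [NormedAddCommGroup V] [NormedSpace ℝ V]
    (hu : UniqueDiffOn ℝ D) {f : ST → V} (hf : ContDiffOn ℝ 2 f D) (w : ST) :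
    ContDiffOn ℝ 1 (fun p => fderivWithin ℝ f D p w) D :=
  (hf.fderivWithin hu (by norm_num)).clm_apply contDiffOn_const

theorem contDiffOn_ofReal {n : WithTop ℕ∞} {α : ST → ℝ} (hα : ContDiffOn ℝ n α D) :
    ContDiffOn ℝ n (fun p => (α p : ℂ)) D :=
  Complex.ofRealCLM.contDiff.comp_contDiffOn hα

theorem contDiffOn_cov (hu : UniqueDiffOn ℝ D) {f : ST → ℂ} (hf : ContDiffOn ℝ 2 f D)
    {α : ST → ℝ} (hα : ContDiffOn ℝ 2 α D) (w : ST) : ContDiffOn ℝ 1 (cov D α w f) D :=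
  (contDiffOn_fderivWithin_apply hu hf w).add
    ((contDiffOn_const.mul (contDiffOn_ofReal (hα.of_le (by norm_num)))).mul
      (hf.of_le (by norm_num)))

theorem fderivWithin_cov (hu : UniqueDiffOn ℝ D) (hp : p ∈ D) {f : ST → ℂ}
    (hf : ContDiffOn ℝ 2 f D) {α : ST → ℝ} (hα : ContDiffOn ℝ 2 α D) (v w : ST) :
    fderivWithin ℝ (cov D α v f) D p w =
      fderivWithin ℝ (fderivWithin ℝ f D) D p w v +
        Complex.I * (fderivWithin ℝ α D p w * f p + α p * fderivWithin ℝ f D p w) := by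
  have h1 : HasFDerivWithinAt (fderivWithin ℝ f D) (fderivWithin ℝ (fderivWithin ℝ f D) D p) D p :=
    hasFDerivWithinAt_of_contDiffOn_one (hf.fderivWithin hu (by norm_num)) hp
  have h2 : HasFDerivWithinAt f (fderivWithin ℝ f D p) D p :=
    hasFDerivWithinAt_of_contDiffOn_one (hf.of_le (by norm_num)) hp
  have h3 : HasFDerivWithinAt (fun p => (α p : ℂ)) (Complex.ofRealCLM.comp (fderivWithin ℝ α D p))
      D p := Complex.ofRealCLM.hasFDerivAt.comp_hasFDerivWithinAt p
        (hasFDerivWithinAt_of_contDiffOn_one (hα.of_le (by norm_num)) hp)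
  have h4 := (h1.clm_apply (hasFDerivWithinAt_const v p D)).add ((h3.const_mul Complex.I).mul h2)
  have h5 : fderivWithin ℝ (cov D α v f) D p w = _ :=
    congrArg (fun L => L w) (h4.fderivWithin (hu p hp))
  rw [h5]
  simp
  ring

/-- Covariant derivatives commute up to the curvature of the connection. -/
theorem cov_cov_sub (hu : UniqueDiffOn ℝ D) (hD : D ⊆ closure (interior D)) (hp : p ∈ D)
    {f : ST → ℂ} (hf : ContDiffOn ℝ 2 f D) {α β : ST → ℝ} (hα : ContDiffOn ℝ 2 α D)
    (hβ : ContDiffOn ℝ 2 β D) (v w : ST) :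
    cov D α w (cov D β v f) p = cov D β v (cov D α w f) p +
      Complex.I * (fderivWithin ℝ β D p w - fderivWithin ℝ α D p v) * f p := by
  have hsymm : IsSymmSndFDerivWithinAt ℝ f D p :=
    (hf p hp).isSymmSndFDerivWithinAt (by simp) hu (hD hp) hp
  have h1 : cov D α w (cov D β v f) p =
    fderivWithin ℝ (cov D β v f) D p w + Complex.I * α p * cov D β v f p := rfl
  have h2 : cov D β v (cov D α w f) p =
    fderivWithin ℝ (cov D α w f) D p v + Complex.I * β p * cov D α w f p := rfl
  rw [h1, h2, fderivWithin_cov hu hp hf hβ, fderivWithin_cov hu hp hf hα, hsymm.eq v w]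
  simp only [cov]
  ring

end Covariant

/-! ### The nonlinearity -/

namespace Nonlinearity

variable (N : Nonlinearity) {a : ℝ}

/-- The scaled nonlinear term is `g` with the amplitude rescaled by `a^{3/2}`, so it inherits the
continuity of `g` at the zeros of `ψ`. -/
theorem nonlinTerm_scaled' (ha : 0 < a) (z : ℂ) :
    nonlinTerm (N.scaled' a) z =
      (((a ^ 2)⁻¹ * (√(a ^ 3))⁻¹ : ℝ) : ℂ) * nonlinTerm N.G' ((√(a ^ 3) : ℝ) * z) := by
  have hb : 0 < √(a ^ 3) := by positivity
  have hb2 : √(a ^ 3) * √(a ^ 3) = a ^ 3 := Real.mul_self_sqrt (by positivity)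
  have hbc : ((√(a ^ 3) : ℝ) : ℂ) ≠ 0 := by exact_mod_cast hb.ne'
  by_cases hz : z = 0
  · simp [nonlinTerm, hz]
  · rw [nonlinTerm, nonlinTerm, if_neg hz, if_neg (mul_ne_zero hbc hz), Complex.normSq_mul,
      Complex.normSq_ofReal, hb2, scaled']
    push_cast
    field_simp

theorem continuous_nonlinTerm_scaled' (ha : 0 < a) : Continuous (nonlinTerm (N.scaled' a)) := by
  rw [funext (N.nonlinTerm_scaled' ha)]
  exact continuous_const.mul (N.continuous_g.comp (by fun_prop))

/-- The differential `2 Re (g* dψ)` of `ψ ↦ G_a(|ψ|²)`. -/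
def scaledDifferential (a : ℝ) (z : ℂ) : ℂ →L[ℝ] ℝ :=
  (2 : ℝ) • Complex.reCLM.comp (ContinuousLinearMap.mul ℝ ℂ (star (nonlinTerm (N.scaled' a) z)))

theorem hasFDerivAt_scaled (ha : 0 < a) (z : ℂ) :
    HasFDerivAt (fun w => N.scaled a (Complex.normSq w)) (N.scaledDifferential a z) z := by
  set b := √(a ^ 3)
  have hb : 0 < b := by positivity
  have hb2 : b * b = a ^ 3 := Real.mul_self_sqrt (by positivity)
  obtain ⟨L, hL, hLw⟩ := N.differential (b * z)
  have h1 : HasFDerivAt (fun w : ℂ => (b : ℂ) * w) (ContinuousLinearMap.mul ℝ ℂ b) z :=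
    (ContinuousLinearMap.mul ℝ ℂ b).hasFDerivAt
  have h2 := (hL.comp z h1).const_mul (a ^ 5)⁻¹
  refine (h2.congr_of_eventuallyEq (Eventually.of_forall fun w => ?_)).congr_fderiv ?_
  · simp only [scaled, Function.comp, Complex.normSq_mul, Complex.normSq_ofReal, hb2]
  · ext w
    have h3 : L (b * w) = 2 * (star (nonlinTerm N.G' (b * z)) * (b * w)).re := by
      have := congrArg Complex.re (hLw (b * w))
      rw [Complex.ofReal_re] at this
      rw [this]
      simp
      ring
    have ha5 : (a ^ 5)⁻¹ * b = (a ^ 2)⁻¹ * b⁻¹ := by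
      field_simp
      rw [sq, hb2]
    simp only [scaledDifferential, N.nonlinTerm_scaled' ha]
    simp only [_root_.smul_apply, ContinuousLinearMap.comp_apply,
      ContinuousLinearMap.mul_apply', h3, smul_eq_mul, Complex.reCLM_apply]
    have h4 : star (nonlinTerm N.G' (b * z)) * (b * w) =
      (b : ℝ) * (star (nonlinTerm N.G' (b * z)) * w) := by ring
    rw [h4, Complex.re_ofReal_mul, star_mul', Complex.star_def, Complex.conj_ofReal, mul_assoc,
      Complex.re_ofReal_mul, ← ha5]
    ring

theorem contDiff_scaled (ha : 0 < a) :
    ContDiff ℝ 1 fun w : ℂ => N.scaled a (Complex.normSq w) := by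
  refine contDiff_one_iff_hasFDerivAt.2
    ⟨N.scaledDifferential a, ?_, fun z => N.hasFDerivAt_scaled ha z⟩
  unfold scaledDifferential
  have h := (ContinuousLinearMap.mul ℝ ℂ).continuous.comp
    (N.continuous_nonlinTerm_scaled' ha).star
  exact (continuous_const.clm_comp h).const_smul (2 : ℝ)

/-- In the chain rule for the gauge invariant `G_a(|ψ|²)`, derivatives of `ψ` can be replaced by
covariant ones. -/
theorem fderivWithin_scaled {D : Set ST} {p : ST} (hu : UniqueDiffWithinAt ℝ D p) (ha : 0 < a)
    {f : ST → ℂ} (hf : DifferentiableWithinAt ℝ f D p) (α : ST → ℝ) (w : ST) :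
    fderivWithin ℝ (fun p => N.scaled a (Complex.normSq (f p))) D p w =
      2 * (star (nonlinTerm (N.scaled' a) (f p)) * cov D α w f p).re := by
  have h := (N.hasFDerivAt_scaled ha (f p)).comp_hasFDerivWithinAt p hf.hasFDerivWithinAt
  have h2 : fderivWithin ℝ (fun p => N.scaled a (Complex.normSq (f p))) D p w = _ :=
    congrArg (fun L => L w) (h.fderivWithin hu)
  rw [h2]
  simp only [scaledDifferential, cov, nonlinTerm]
  split_ifs with h0
  · simp
  · simp
    ring

end Nonlinearity

/-! ### Local conservation laws -/

section ConservationLaws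

variable {K : Constants} {N : Nonlinearity} {a : ℝ} {D : Set ST} {φ : ST → ℝ} {A : ST → E3}
  {ψ : ST → ℂ} {p : ST}

/-- The connection coefficient `q φ / χ` of the covariant time derivative. -/
def connT (K : Constants) (φ : ST → ℝ) (p : ST) : ℝ := K.q / K.χ * φ p

/-- The connection coefficient `-q Aᵢ / (χ c)` of the covariant spatial derivative. -/
def connX (K : Constants) (A : ST → E3) (i : Fin 3) (p : ST) : ℝ := -(K.q / (K.χ * K.c)) * A p i

/-- The `i`-th coordinate direction of space as a space-time vector. -/
abbrev dirX (i : Fin 3) : ST := (0, EuclideanSpace.single i (1 : ℝ))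

theorem covT_eq_cov : covT K D φ ψ = cov D (connT K φ) (1, 0) ψ := by
  ext p
  simp only [covT, cov, connT, dt]
  push_cast
  ring

theorem covX_eq_cov (i : Fin 3) : covX K D A ψ i = cov D (connX K A i) (dirX i) ψ := by
  ext p
  simp only [covX, cov, connX, dx]
  push_cast
  ring

theorem contDiffOn_coord {n : WithTop ℕ∞} (hA : ContDiffOn ℝ n A D) (i : Fin 3) :
    ContDiffOn ℝ n (fun p => A p i) D :=
  (EuclideanSpace.proj (𝕜 := ℝ) i).contDiff.comp_contDiffOn hA

theorem fderivWithin_coord (hu : UniqueDiffWithinAt ℝ D p) (hA : DifferentiableWithinAt ℝ A D p)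
    (i : Fin 3) (w : ST) : fderivWithin ℝ (fun p => A p i) D p w = fderivWithin ℝ A D p w i := by
  have h := (EuclideanSpace.proj (𝕜 := ℝ) i).hasFDerivAt.comp_hasFDerivWithinAt p
    hA.hasFDerivWithinAt
  exact congrArg (fun L => L w) (h.fderivWithin hu)

theorem contDiffOn_connT (hφ : ContDiffOn ℝ 2 φ D) : ContDiffOn ℝ 2 (connT K φ) D :=
  contDiffOn_const.mul hφ

theorem contDiffOn_connX (hA : ContDiffOn ℝ 2 A D) (i : Fin 3) :
    ContDiffOn ℝ 2 (connX K A i) D :=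
  contDiffOn_const.mul (contDiffOn_coord hA i)

theorem contDiffOn_star_mul {n : WithTop ℕ∞} {f g : ST → ℂ} (hf : ContDiffOn ℝ n f D)
    (hg : ContDiffOn ℝ n g D) : ContDiffOn ℝ n (fun p => star (f p) * g p) D :=
  (Complex.conjCLE.contDiff.comp_contDiffOn hf).mul hg

theorem contDiffOn_re {n : WithTop ℕ∞} {f : ST → ℂ} (hf : ContDiffOn ℝ n f D) :
    ContDiffOn ℝ n (fun p => (f p).re) D := Complex.reCLM.contDiff.comp_contDiffOn hf

theorem contDiffOn_im {n : WithTop ℕ∞} {f : ST → ℂ} (hf : ContDiffOn ℝ n f D) :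
    ContDiffOn ℝ n (fun p => (f p).im) D := Complex.imCLM.contDiff.comp_contDiffOn hf

theorem contDiffOn_covX (hu : UniqueDiffOn ℝ D) (hA : ContDiffOn ℝ 2 A D)
    (hψ : ContDiffOn ℝ 2 ψ D) (i : Fin 3) : ContDiffOn ℝ 1 (covX K D A ψ i) D := by
  rw [covX_eq_cov]
  exact contDiffOn_cov hu hψ (contDiffOn_connX hA i) _

theorem contDiffOn_covT (hu : UniqueDiffOn ℝ D) (hφ : ContDiffOn ℝ 2 φ D)
    (hψ : ContDiffOn ℝ 2 ψ D) : ContDiffOn ℝ 1 (covT K D φ ψ) D := by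
  rw [covT_eq_cov]
  exact contDiffOn_cov hu hψ (contDiffOn_connT hφ) _

theorem momentum_apply (i : Fin 3) (p : ST) :
    momentum K D A ψ p i = K.χ * (star (ψ p) * covX K D A ψ i p).im := by
  simp [momentum]
  ring

/-- Current and momentum densities are proportional; this is what links the momentum balance to the
motion of the charge centers. -/
theorem current_eq_smul_momentum (p : ST) :
    current K D A ψ p = (K.q / K.m) • momentum K D A ψ p := by
  ext i
  have := K.m_pos.ne'
  have h : (K.q * K.χ / (2 * K.m) : ℂ) = ((K.q * K.χ / (2 * K.m) : ℝ) : ℂ) := by push_cast; rfl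
  have h2 : K.q / K.m * K.χ = 2 * (K.q * K.χ / (2 * K.m)) := by field_simp
  simp only [current, PiLp.smul_apply, smul_eq_mul, momentum_apply, h, ← mul_assoc, h2]
  generalize K.q * K.χ / (2 * K.m) = r
  simp
  ring

theorem chargeDensity_eq (p : ST) : chargeDensity K ψ p = K.q * (star (ψ p) * ψ p).re := by
  simp [chargeDensity, Complex.normSq_apply]

/-- The diagonal part `(χ²/2m)(|∇̃ψ|² + G_a(|ψ|²)) + χ Im(ψ* ∂̃ₜψ)` of the stress tensor. -/
def isoStress (K : Constants) (N : Nonlinearity) (a : ℝ) (D : Set ST) (φ : ST → ℝ) (A : ST → E3)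
    (ψ : ST → ℂ) (p : ST) : ℝ :=
  K.χ ^ 2 / (2 * K.m) * ((∑ k : Fin 3, (star (covX K D A ψ k p) * covX K D A ψ k p).re) +
    N.scaled a (Complex.normSq (ψ p))) + K.χ * (star (ψ p) * covT K D φ ψ p).im

theorem stress_eq (i j : Fin 3) (p : ST) :
    stress K N a D φ A ψ i j p = (if i = j then isoStress K N a D φ A ψ p else 0) -
      K.χ ^ 2 / K.m * (star (covX K D A ψ i p) * covX K D A ψ j p).re := by
  have := K.m_pos.ne'
  unfold stress
  split_ifs with h
  · subst h
    simp [energyDensity, isoStress, Complex.normSq_apply]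
    ring
  · simp
    field_simp
    ring

theorem contDiffOn_isoStress (hu : UniqueDiffOn ℝ D) (ha : 0 < a) (hφ : ContDiffOn ℝ 2 φ D)
    (hA : ContDiffOn ℝ 2 A D) (hψ : ContDiffOn ℝ 2 ψ D) :
    ContDiffOn ℝ 1 (isoStress K N a D φ A ψ) D := by
  have hψ1 := hψ.of_le (m := 1) (by norm_num)
  refine ContDiffOn.add (contDiffOn_const.mul (ContDiffOn.add (ContDiffOn.sum fun k _ => ?_)
    ((N.contDiff_scaled ha).comp_contDiffOn hψ1))) (contDiffOn_const.mul ?_)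
  · exact contDiffOn_re (contDiffOn_star_mul (contDiffOn_covX hu hA hψ k)
      (contDiffOn_covX hu hA hψ k))
  · exact contDiffOn_im (contDiffOn_star_mul hψ1 (contDiffOn_covT hu hφ hψ))

theorem contDiffOn_stress (hu : UniqueDiffOn ℝ D) (ha : 0 < a) (hφ : ContDiffOn ℝ 2 φ D)
    (hA : ContDiffOn ℝ 2 A D) (hψ : ContDiffOn ℝ 2 ψ D) (i j : Fin 3) :
    ContDiffOn ℝ 1 (stress K N a D φ A ψ i j) D := by
  rw [show stress K N a D φ A ψ i j = _ from funext (stress_eq i j)]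
  refine ContDiffOn.sub ?_ (contDiffOn_const.mul (contDiffOn_re (contDiffOn_star_mul
    (contDiffOn_covX hu hA hψ i) (contDiffOn_covX hu hA hψ j))))
  split_ifs
  · exact contDiffOn_isoStress hu ha hφ hA hψ
  · exact contDiffOn_const

theorem contDiffOn_chargeDensity {n : WithTop ℕ∞} (hψ : ContDiffOn ℝ n ψ D) :
    ContDiffOn ℝ n (chargeDensity K ψ) D := by
  rw [show chargeDensity K ψ = _ from funext chargeDensity_eq]
  exact contDiffOn_const.mul (contDiffOn_re (contDiffOn_star_mul hψ hψ))

theorem contDiffOn_momentum (hu : UniqueDiffOn ℝ D) (hA : ContDiffOn ℝ 2 A D)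
    (hψ : ContDiffOn ℝ 2 ψ D) : ContDiffOn ℝ 1 (momentum K D A ψ) D := by
  rw [contDiffOn_euclidean]
  intro i
  simp_rw [momentum_apply]
  exact contDiffOn_const.mul (contDiffOn_im (contDiffOn_star_mul (hψ.of_le (by norm_num))
    (contDiffOn_covX hu hA hψ i)))

theorem contDiffOn_current (hu : UniqueDiffOn ℝ D) (hA : ContDiffOn ℝ 2 A D)
    (hψ : ContDiffOn ℝ 2 ψ D) : ContDiffOn ℝ 1 (current K D A ψ) D := by
  rw [show current K D A ψ = _ from funext current_eq_smul_momentum]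
  exact (contDiffOn_momentum hu hA hψ).const_smul _

theorem fderivWithin_re_star_mul (hu : UniqueDiffWithinAt ℝ D p) {f g : ST → ℂ}
    (hf : DifferentiableWithinAt ℝ f D p) (hg : DifferentiableWithinAt ℝ g D p)
    (α : ST → ℝ) (w : ST) :
    fderivWithin ℝ (fun p => (star (f p) * g p).re) D p w =
      (star (cov D α w f p) * g p + star (f p) * cov D α w g p).re := by
  rw [(hasFDerivWithinAt_re_star_mul hf hg).fderivWithin hu, ← fderivWithin_star_mul hu hf hg]
  rfl

theorem fderivWithin_im_star_mul (hu : UniqueDiffWithinAt ℝ D p) {f g : ST → ℂ}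
    (hf : DifferentiableWithinAt ℝ f D p) (hg : DifferentiableWithinAt ℝ g D p)
    (α : ST → ℝ) (w : ST) :
    fderivWithin ℝ (fun p => (star (f p) * g p).im) D p w =
      (star (cov D α w f p) * g p + star (f p) * cov D α w g p).im := by
  rw [(hasFDerivWithinAt_im_star_mul hf hg).fderivWithin hu, ← fderivWithin_star_mul hu hf hg]
  rfl

theorem fderivWithin_const_mul_apply (hu : UniqueDiffWithinAt ℝ D p) {f : ST → ℝ}
    (hf : DifferentiableWithinAt ℝ f D p) (b : ℝ) (w : ST) :
    fderivWithin ℝ (fun p => b * f p) D p w = b * fderivWithin ℝ f D p w :=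
  congrArg (fun L => L w) ((hf.hasFDerivWithinAt.const_mul b).fderivWithin hu)

theorem fderivWithin_connT (hu : UniqueDiffWithinAt ℝ D p) (hφ : DifferentiableWithinAt ℝ φ D p)
    (w : ST) : fderivWithin ℝ (connT K φ) D p w = K.q / K.χ * fderivWithin ℝ φ D p w :=
  fderivWithin_const_mul_apply hu hφ _ w

theorem fderivWithin_connX (hu : UniqueDiffWithinAt ℝ D p) (hA : DifferentiableWithinAt ℝ A D p)
    (i : Fin 3) (w : ST) :
    fderivWithin ℝ (connX K A i) D p w = -(K.q / (K.χ * K.c)) * fderivWithin ℝ A D p w i := by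
  rw [← fderivWithin_coord hu hA]
  exact fderivWithin_const_mul_apply hu ((EuclideanSpace.proj (𝕜 := ℝ)
    i).hasFDerivAt.comp_hasFDerivWithinAt p hA.hasFDerivWithinAt).differentiableWithinAt _ w

/-- Conservation of charge: `∂ₜ ρ + ∇ · J = 0`. The potentials and the nonlinear term drop out,
since `ψ* G_a'(|ψ|²)ψ` is real. -/
theorem continuity_equation (hu : UniqueDiffOn ℝ D) (hp : p ∈ D) (hA : ContDiffOn ℝ 2 A D)
    (hψ : ContDiffOn ℝ 2 ψ D) (hsol : SolvesNLS K N a D φ A ψ) :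
    dt D (chargeDensity K ψ) p = -∑ i : Fin 3, dx D i (fun p => current K D A ψ p i) p := by
  have hm := K.m_pos.ne'
  have hdψ : DifferentiableWithinAt ℝ ψ D p := hψ.differentiableOn (by norm_num) p hp
  have hdX : ∀ i, DifferentiableWithinAt ℝ (covX K D A ψ i) D p := fun i =>
    (contDiffOn_covX hu hA hψ i).differentiableOn one_ne_zero p hp
  have h1 : dt D (chargeDensity K ψ) p = 2 * K.q * (star (ψ p) * covT K D φ ψ p).re := by
    rw [show chargeDensity K ψ = _ from funext chargeDensity_eq, dt,
      fderivWithin_const_mul_apply (hu p hp)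
        (hasFDerivWithinAt_re_star_mul hdψ hdψ).differentiableWithinAt,
      fderivWithin_re_star_mul (hu p hp) hdψ hdψ (connT K φ), covT_eq_cov]
    simp
    ring
  have h2 : ∀ i, dx D i (fun p => current K D A ψ p i) p = K.q * K.χ / K.m *
      (star (ψ p) * covX K D A (covX K D A ψ i) i p).im := by
    intro i
    have : (fun p => current K D A ψ p i) =
        fun p => K.q * K.χ / K.m * (star (ψ p) * covX K D A ψ i p).im := by
      ext p
      rw [current_eq_smul_momentum, PiLp.smul_apply, momentum_apply, smul_eq_mul]
      ring
    rw [this, dx, fderivWithin_const_mul_apply (hu p hp)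
        (hasFDerivWithinAt_im_star_mul hdψ (hdX i)).differentiableWithinAt,
      fderivWithin_im_star_mul (hu p hp) hdψ (hdX i) (connX K A i), ← covX_eq_cov, ← covX_eq_cov,
      Complex.add_im, Complex.star_def, Complex.conj_mul', ← Complex.ofReal_pow, Complex.ofReal_im,
      zero_add]
  have h3 : (star (ψ p) * nonlinTerm (N.scaled' a) (ψ p)).im = 0 := by
    unfold nonlinTerm
    split_ifs
    · simp
    · simp
      ring
  have h4 : (star (ψ p) * covT K D φ ψ p).re =
      (star (ψ p) * (Complex.I * covT K D φ ψ p)).im := by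
    simp
  have h5 : (K.χ / (2 * K.m) : ℂ) = ((K.χ / (2 * K.m) : ℝ) : ℂ) := by push_cast; rfl
  rw [h1, h4, hsol p hp, h5, mul_left_comm, Complex.im_ofReal_mul, mul_add, Complex.add_im, h3]
  simp_rw [h2]
  rw [← Finset.mul_sum, mul_neg, Complex.neg_im, Finset.mul_sum, Complex.im_sum]
  field_simp
  ring

/-- Balance of momentum: `∂ₜ P^j = ∑ᵢ ∂ᵢ T^{ij} + ρ E^j + (c⁻¹ J × B)^j`. -/
theorem momentum_equation (hu : UniqueDiffOn ℝ D) (hD : D ⊆ closure (interior D)) (hp : p ∈ D)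
    (ha : 0 < a) (hφ : ContDiffOn ℝ 2 φ D) (hA : ContDiffOn ℝ 2 A D)
    (hψ : ContDiffOn ℝ 2 ψ D) (hsol : SolvesNLS K N a D φ A ψ) (j : Fin 3) :
    dt D (fun p => momentum K D A ψ p j) p =
      (∑ i : Fin 3, dx D i (stress K N a D φ A ψ i j) p) +
        (chargeDensity K ψ p • electric K.c D φ A p +
          cross (K.c⁻¹ • current K D A ψ p) (magnetic D A p)) j := by
  have hm := K.m_pos.ne'
  have hχ := K.χ_pos.ne'
  have hc := K.c_pos.ne'
  have hup := hu p hp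
  have hdψ : DifferentiableWithinAt ℝ ψ D p := hψ.differentiableOn (by norm_num) p hp
  have hdX : ∀ i, DifferentiableWithinAt ℝ (covX K D A ψ i) D p := fun i =>
    (contDiffOn_covX hu hA hψ i).differentiableOn one_ne_zero p hp
  have hdT : DifferentiableWithinAt ℝ (covT K D φ ψ) D p :=
    (contDiffOn_covT hu hφ hψ).differentiableOn one_ne_zero p hp
  have hdA : DifferentiableWithinAt ℝ A D p := hA.differentiableOn (by norm_num) p hp
  have hdφ : DifferentiableWithinAt ℝ φ D p := hφ.differentiableOn (by norm_num) p hp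
  -- the curvature of the connection in the time and `j` directions is the electric field
  have hcommT : cov D (connT K φ) (1, 0) (covX K D A ψ j) p =
      cov D (connX K A j) (dirX j) (covT K D φ ψ) p +
        Complex.I * (K.q / K.χ * electric K.c D φ A p j : ℝ) * ψ p := by
    rw [covX_eq_cov, covT_eq_cov, cov_cov_sub hu hD hp hψ (contDiffOn_connT hφ)
      (contDiffOn_connX hA j)]
    congr 3
    rw [← Complex.ofReal_sub]
    congr 1
    rw [fderivWithin_connT hup hdφ, fderivWithin_connX hup hdA]
    simp [electric, grad, dt, dx]
    field_simp
    ring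
  -- the curvature in two spatial directions is the magnetic field
  have hcommX : ∀ i, cov D (connX K A j) (dirX j) (covX K D A ψ i) p =
      covX K D A (covX K D A ψ j) i p +
        Complex.I * (-(K.q / (K.χ * K.c)) * (dx D j A p i - dx D i A p j) : ℝ) * ψ p := by
    intro i
    rw [covX_eq_cov, covX_eq_cov, covX_eq_cov, cov_cov_sub hu hD hp hψ (contDiffOn_connX hA j)
      (contDiffOn_connX hA i)]
    congr 3
    rw [← Complex.ofReal_sub]
    congr 1
    rw [fderivWithin_connX hup hdA, fderivWithin_connX hup hdA]
    simp [dx]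
    ring
  have hP : dt D (fun p => momentum K D A ψ p j) p = K.χ *
      (star (covT K D φ ψ p) * covX K D A ψ j p +
        star (ψ p) * cov D (connT K φ) (1, 0) (covX K D A ψ j) p).im := by
    simp_rw [momentum_apply]
    rw [dt, fderivWithin_const_mul_apply hup
        (hasFDerivWithinAt_im_star_mul hdψ (hdX j)).differentiableWithinAt,
      fderivWithin_im_star_mul hup hdψ (hdX j) (connT K φ), ← covT_eq_cov]
  have hIso : dx D j (isoStress K N a D φ A ψ) p =
      K.χ ^ 2 / (2 * K.m) * ((∑ k : Fin 3,
        (star (cov D (connX K A j) (dirX j) (covX K D A ψ k) p) * covX K D A ψ k p +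
          star (covX K D A ψ k p) * cov D (connX K A j) (dirX j) (covX K D A ψ k) p).re) +
        2 * (star (nonlinTerm (N.scaled' a) (ψ p)) * covX K D A ψ j p).re) +
      K.χ * (star (covX K D A ψ j p) * covT K D φ ψ p +
        star (ψ p) * cov D (connX K A j) (dirX j) (covT K D φ ψ) p).im := by
    have hs1 : ∀ k ∈ Finset.univ, HasFDerivWithinAt
        (fun p => (star (covX K D A ψ k p) * covX K D A ψ k p).re) _ D p := fun k _ =>
      (hasFDerivWithinAt_re_star_mul (hdX k) (hdX k)).differentiableWithinAt.hasFDerivWithinAt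
    have hs2 : HasFDerivWithinAt (fun p => N.scaled a (Complex.normSq (ψ p)))
        (fderivWithin ℝ (fun p => N.scaled a (Complex.normSq (ψ p))) D p) D p :=
      ((N.hasFDerivAt_scaled ha (ψ p)).comp_hasFDerivWithinAt p
        hdψ.hasFDerivWithinAt).differentiableWithinAt.hasFDerivWithinAt
    have hs3 := (hasFDerivWithinAt_im_star_mul hdψ hdT).differentiableWithinAt.hasFDerivWithinAt
    have hs := (((HasFDerivWithinAt.fun_sum hs1).add hs2).const_mul
      (K.χ ^ 2 / (2 * K.m))).add (hs3.const_mul K.χ)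
    have hs' : dx D j (isoStress K N a D φ A ψ) p = _ :=
      congrArg (fun L => L (dirX j)) (hs.fderivWithin hup)
    rw [hs']
    simp only [_root_.add_apply, _root_.smul_apply, _root_.sum_apply, smul_eq_mul]
    rw [N.fderivWithin_scaled hup ha hdψ (connX K A j),
      fderivWithin_im_star_mul hup hdψ hdT (connX K A j), ← covX_eq_cov]
    simp_rw [fderivWithin_re_star_mul hup (hdX _) (hdX _) (connX K A j)]
  have hT : ∀ i, dx D i (stress K N a D φ A ψ i j) p =
      (if i = j then dx D j (isoStress K N a D φ A ψ) p else 0) - K.χ ^ 2 / K.m *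
        (star (covX K D A (covX K D A ψ i) i p) * covX K D A ψ j p +
          star (covX K D A ψ i p) * covX K D A (covX K D A ψ j) i p).re := by
    intro i
    have hd := (hasFDerivWithinAt_re_star_mul (hdX i) (hdX j)).differentiableWithinAt
    rw [show stress K N a D φ A ψ i j = _ from funext (stress_eq i j), dx]
    have h0 : HasFDerivWithinAt (fun p => if i = j then isoStress K N a D φ A ψ p else 0)
        (if i = j then fderivWithin ℝ (isoStress K N a D φ A ψ) D p else 0) D p := by
      split_ifs
      · exact hasFDerivWithinAt_of_contDiffOn_one (contDiffOn_isoStress hu ha hφ hA hψ) hp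
      · exact hasFDerivWithinAt_const _ _ _
    have h1 := congrArg (fun L => L (dirX i))
      ((h0.sub (hd.hasFDerivWithinAt.const_mul (K.χ ^ 2 / K.m))).fderivWithin hup)
    refine h1.trans ?_
    simp only [_root_.sub_apply, _root_.smul_apply, smul_eq_mul]
    rw [fderivWithin_re_star_mul hup (hdX i) (hdX j) (connX K A i), ← covX_eq_cov, ← covX_eq_cov]
    congr 1
    split_ifs with h
    · subst h; rfl
    · rfl
  have hsolp : covT K D φ ψ p = -Complex.I * ((K.χ / (2 * K.m) : ℝ) *
      (-(∑ i : Fin 3, covX K D A (covX K D A ψ i) i p) + nonlinTerm (N.scaled' a) (ψ p))) := by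
    have := hsol p hp
    push_cast
    rw [← this, ← mul_assoc]
    simp
  -- what remains is an algebraic identity between the values at `p`; the second covariant
  -- derivatives `∂̃ₖ ∂̃ₖ ψ` cancel after `∂̃ₜ ψ` is eliminated by the equation
  obtain ⟨r, hr⟩ : ∃ r, r = K.χ / (2 * K.m) := ⟨_, rfl⟩
  obtain ⟨s, hs⟩ : ∃ s, s = K.q / (K.χ * K.c) := ⟨_, rfl⟩
  rw [← hr] at hsolp
  simp only [← hs] at hcommX
  simp_rw [hT]
  rw [Finset.sum_sub_distrib, Finset.sum_ite_eq' Finset.univ j, if_pos (Finset.mem_univ j), hIso,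
    hP, hcommT]
  simp_rw [hcommX]
  have hcross : ∀ u v : E3, cross u v j = (![u 1 * v 2 - u 2 * v 1, u 2 * v 0 - u 0 * v 2,
      u 0 * v 1 - u 1 * v 0] : Fin 3 → ℝ) j := fun u v => by
    simp [cross, cross_apply]
  rw [chargeDensity_eq, current_eq_smul_momentum, PiLp.add_apply, hcross]
  simp only [PiLp.smul_apply, momentum_apply, smul_eq_mul, magnetic, curl]
  generalize cov D (connX K A j) (dirX j) (covT K D φ ψ) p = W
  rw [hsolp]
  generalize electric K.c D φ A p = E
  generalize covX K D A ψ = X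
  generalize nonlinTerm (N.scaled' a) (ψ p) = g
  generalize ψ p = z
  obtain rfl | rfl | rfl : j = 0 ∨ j = 1 ∨ j = 2 := by fin_cases j <;> simp
  all_goals
    simp [Fin.sum_univ_three]
    rw [hr, hs]
    field_simp
    ring

end ConservationLaws

/-! ### Boundary integrals and vector-valued transport -/

namespace Trajectory

variable (γ : Trajectory) {R : ℝ}

/-- Joint continuity in time and in the unit normal of an integrand on the moving sphere. -/
def BdryContinuous {V : Type*} [TopologicalSpace V] (R : ℝ) (f : ℝ → E3 → E3 → V) : Prop :=
  ContinuousOn (fun p : ℝ × Metric.sphere (0 : E3) 1 => f p.1 (γ.pos p.1 + R • (p.2 : E3)) p.2)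
    (γ.I ×ˢ univ)

section

variable {γ}

theorem bdryContinuous_of_continuousOn {V : Type*} [TopologicalSpace V] (hR : 0 < R) {f : ST → V}
    (hf : ContinuousOn f (γ.tube R)) : γ.BdryContinuous R fun t x _ => f (t, x) :=
  γ.continuousOn_sphere_param hR hf

theorem bdryContinuous_normal : γ.BdryContinuous R fun _ _ ν => ν :=
  Continuous.continuousOn (by fun_prop)

theorem bdryContinuous_vel : γ.BdryContinuous R fun t _ ν => (inner ℝ (γ.vel t) ν : ℝ) :=
  ContinuousOn.inner (γ.continuousOn_vel.comp continuousOn_fst fun _ hp => hp.1)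
    (Continuous.continuousOn (by fun_prop))

theorem BdryContinuous.inner {f g : ℝ → E3 → E3 → E3} (hf : γ.BdryContinuous R f)
    (hg : γ.BdryContinuous R g) :
    γ.BdryContinuous R fun t x ν => (inner ℝ (f t x ν) (g t x ν) : ℝ) :=
  ContinuousOn.inner hf hg

theorem BdryContinuous.integrable {V : Type*} [NormedAddCommGroup V]
    {f : ℝ → E3 → E3 → V} (hf : γ.BdryContinuous R f) {t : ℝ}
    (ht : t ∈ γ.I) : Integrable (fun ω : Metric.sphere (0 : E3) 1 => f t (γ.pos t + R • (ω : E3)) ω)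
      ((volume : Measure E3).toSphere) := by
  have : Continuous fun ω : Metric.sphere (0 : E3) 1 => f t (γ.pos t + R • (ω : E3)) ω :=
    continuousOn_univ.1
      (hf.comp (f := fun ω => (t, ω)) (by fun_prop) fun ω _ => ⟨ht, trivial⟩)
  exact this.integrable_of_hasCompactSupport (HasCompactSupport.of_compactSpace _)

variable {V : Type*} [NormedAddCommGroup V] [NormedSpace ℝ V]

theorem BdryContinuous.smul {f : ℝ → E3 → E3 → ℝ} {g : ℝ → E3 → E3 → V}
    (hf : γ.BdryContinuous R f) (hg : γ.BdryContinuous R g) :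
    γ.BdryContinuous R fun t x ν => f t x ν • g t x ν :=
  ContinuousOn.smul hf hg

theorem BdryContinuous.continuousOn_surfaceIntegral {f : ℝ → E3 → E3 → V}
    (hf : γ.BdryContinuous R f) :
    ContinuousOn (fun t => surfaceIntegral (γ.pos t) R (f t)) γ.I :=
  γ.continuousOn_surfaceIntegral hf

theorem surfaceIntegral_apply {f : ℝ → E3 → E3 → E3} (hf : γ.BdryContinuous R f) {t : ℝ}
    (ht : t ∈ γ.I) (j : Fin 3) :
    surfaceIntegral (γ.pos t) R (f t) j =
      surfaceIntegral (γ.pos t) R fun x ν => f t x ν j := by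
  simp only [surfaceIntegral, PiLp.smul_apply]
  rw [eval_integral_piLp (integrable_piLp_iff.1 (hf.integrable ht))]

theorem surfaceIntegral_smul_sub {f : ℝ → E3 → E3 → ℝ} (hf : γ.BdryContinuous R f) {t : ℝ}
    (ht : t ∈ γ.I) (c : E3) :
    (surfaceIntegral (γ.pos t) R fun x ν => f t x ν • (x - c)) =
      (surfaceIntegral (γ.pos t) R fun x ν => f t x ν • x) -
        (surfaceIntegral (γ.pos t) R (f t)) • c := by
  have hx : γ.BdryContinuous R fun _ x _ => x :=
    ((γ.continuousOn_pos.comp continuousOn_fst fun _ hp => hp.1).add (by fun_prop))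
  have h1 := (hf.smul hx).integrable ht
  have h2 := (hf.integrable ht).smul_const c
  simp only [surfaceIntegral, smul_sub]
  rw [integral_sub h1 h2, integral_smul_const, smul_sub, smul_assoc]

end

/-- The divergence theorem on the balls of a tube. -/
theorem setIntegral_divergence (hR : 0 < R) {F : ST → E3} (hF : ContDiffOn ℝ 1 F (γ.tube R))
    {t : ℝ} (ht : t ∈ γ.I) :
    ∫ x in γ.ball R t, ∑ i : Fin 3, dx (γ.tube R) i (fun p => F p i) (t, x) =
      surfaceIntegral (γ.pos t) R fun x ν => inner ℝ ν (F (t, x)) := by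
  have hi : ∀ i, ContDiffOn ℝ 1 (fun p => F p i) (γ.tube R) := fun i => contDiffOn_coord hF i
  have hb : ∀ i, γ.BdryContinuous R fun t x ν =>
      (inner ℝ (EuclideanSpace.single i (1 : ℝ)) ν : ℝ) • F (t, x) i := fun i =>
    ((bdryContinuous_of_continuousOn hR (f := fun _ => EuclideanSpace.single i (1 : ℝ))
      continuousOn_const).inner bdryContinuous_normal).smul
        (bdryContinuous_of_continuousOn hR (hi i).continuousOn)
  rw [integral_finsetSum]
  · simp_rw [dx, γ.setIntegral_fderivWithin_space hR (hi _) ht]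
    simp only [surfaceIntegral]
    rw [← Finset.smul_sum, ← integral_finsetSum]
    · congr 2
      ext ω
      simp [PiLp.inner_apply, mul_comm]
    · exact fun i _ => (hb i).integrable ht
  · exact fun i _ => γ.integrableOn_slice (f := fun p => dx (γ.tube R) i (fun p => F p i) p)
      (((hi i).continuousOn_fderivWithin (γ.uniqueDiffOn_tube hR) le_rfl).clm_apply
        continuousOn_const) ht

theorem integral_ball_apply {F : ST → E3} (hF : ContinuousOn F (γ.tube R)) {t : ℝ} (ht : t ∈ γ.I)
    (j : Fin 3) : (∫ x in γ.ball R t, F (t, x)) j = ∫ x in γ.ball R t, F (t, x) j :=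
  eval_integral_piLp (integrable_piLp_iff.1 (γ.integrableOn_slice hF ht)) j

theorem continuousOn_dt (hR : 0 < R) {V : Type*} [NormedAddCommGroup V] [NormedSpace ℝ V]
    {F : ST → V} (hF : ContDiffOn ℝ 1 F (γ.tube R)) :
    ContinuousOn (dt (γ.tube R) F) (γ.tube R) :=
  (hF.continuousOn_fderivWithin (γ.uniqueDiffOn_tube hR) le_rfl).clm_apply continuousOn_const

theorem continuousOn_dx (hR : 0 < R) {V : Type*} [NormedAddCommGroup V] [NormedSpace ℝ V]
    {F : ST → V} (hF : ContDiffOn ℝ 1 F (γ.tube R)) (i : Fin 3) :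
    ContinuousOn (dx (γ.tube R) i F) (γ.tube R) :=
  (hF.continuousOn_fderivWithin (γ.uniqueDiffOn_tube hR) le_rfl).clm_apply continuousOn_const

theorem setIntegral_fderivWithin_space_vector (hR : 0 < R) {F : ST → E3}
    (hF : ContDiffOn ℝ 1 F (γ.tube R)) {t : ℝ} (ht : t ∈ γ.I) (v : E3) :
    ∫ x in γ.ball R t, fderivWithin ℝ F (γ.tube R) (t, x) (0, v) =
      surfaceIntegral (γ.pos t) R fun x ν => (inner ℝ v ν : ℝ) • F (t, x) := by
  have hb : γ.BdryContinuous R fun t x ν => (inner ℝ v ν : ℝ) • F (t, x) :=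
    ((bdryContinuous_of_continuousOn hR (f := fun _ => v)
      continuousOn_const).inner bdryContinuous_normal).smul
        (bdryContinuous_of_continuousOn hR hF.continuousOn)
  have hc : ContinuousOn (fun p => fderivWithin ℝ F (γ.tube R) p (0, v)) (γ.tube R) :=
    (hF.continuousOn_fderivWithin (γ.uniqueDiffOn_tube hR) le_rfl).clm_apply continuousOn_const
  ext j
  rw [surfaceIntegral_apply hb ht, γ.integral_ball_apply hc ht]
  refine Eq.trans ?_ (γ.setIntegral_fderivWithin_space hR (contDiffOn_coord hF j) ht v)
  refine setIntegral_congr_fun (γ.measurableSet_ball t) fun x hx => ?_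
  have hp : (t, x) ∈ γ.tube R := ⟨ht, hx⟩
  exact (fderivWithin_coord (γ.uniqueDiffOn_tube hR _ hp)
    (hF.differentiableOn one_ne_zero _ hp) j _).symm

/-- Transport theorem for vector fields. -/
theorem hasDerivWithinAt_integral_ball_vector (hR : 0 < R) {F : ST → E3}
    (hF : ContDiffOn ℝ 1 F (γ.tube R)) {t : ℝ} (ht : t ∈ γ.I) :
    HasDerivWithinAt (fun t => ∫ x in γ.ball R t, F (t, x))
      ((∫ x in γ.ball R t, dt (γ.tube R) F (t, x)) +
        surfaceIntegral (γ.pos t) R fun x ν => (inner ℝ (γ.vel t) ν : ℝ) • F (t, x)) γ.I t := by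
  refine (γ.hasDerivWithinAt_integral_ball_aux hR hF ht).congr_deriv ?_
  rw [← γ.setIntegral_fderivWithin_space_vector hR hF ht]
  rw [← integral_add (γ.integrableOn_slice (γ.continuousOn_dt hR hF) ht)]
  · congr 1
    ext1 x
    rw [dt, ← map_add]
    simp
  · exact γ.integrableOn_slice (f := fun p => fderivWithin ℝ F (γ.tube R) p (0, γ.vel t))
      ((hF.continuousOn_fderivWithin (γ.uniqueDiffOn_tube hR) le_rfl).clm_apply
        continuousOn_const) ht

/-- The fundamental theorem of calculus on `[T₋, T₊]`. -/
theorem integral_eq_sub_of_hasDerivWithinAt {V : Type*} [NormedAddCommGroup V] [NormedSpace ℝ V]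
    [CompleteSpace V] {f f' : ℝ → V} (hf : ∀ t ∈ γ.I, HasDerivWithinAt f (f' t) γ.I t)
    (hf' : ContinuousOn f' γ.I) {s t : ℝ} (hs : s ∈ γ.I) (ht : t ∈ γ.I) :
    ∫ τ in s..t, f' τ = f t - f s := by
  have hsub : uIcc s t ⊆ γ.I := uIcc_subset_Icc hs ht
  refine intervalIntegral.integral_eq_sub_of_hasDeriv_right
    (fun τ hτ => (hf τ (hsub hτ)).continuousWithinAt.mono hsub) (fun τ hτ => ?_)
    (hf'.mono hsub).intervalIntegrable
  have h1 : min s t ∈ γ.I := by rcases min_choice s t with h | h <;> rwa [h]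
  have h2 : max s t ∈ γ.I := by rcases max_choice s t with h | h <;> rwa [h]
  exact ((hf τ (hsub (Ioo_subset_Icc_self hτ))).hasDerivAt
    (Icc_mem_nhds (h1.1.trans_lt hτ.1) (hτ.2.trans_le h2.2))).hasDerivWithinAt

end Trajectory

/-! ### The cross product -/

/-- The cross product as a continuous bilinear map. -/
def crossL : E3 →L[ℝ] E3 →L[ℝ] E3 :=
  LinearMap.toContinuousBilinearMap (LinearMap.mk₂ ℝ cross
    (fun u v w => by simp [cross]) (fun a u v => by simp [cross])
    (fun u v w => by simp [cross]) (fun a u v => by simp [cross]))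

theorem crossL_apply (u v : E3) : crossL u v = cross u v := rfl

theorem _root_.ContinuousOn.cross {X : Type*} [TopologicalSpace X] {s : Set X} {f g : X → E3}
    (hf : ContinuousOn f s) (hg : ContinuousOn g s) :
    ContinuousOn (fun x => cross (f x) (g x)) s :=
  (crossL.continuous.comp_continuousOn hf).clm_apply hg

/-! ### Balance laws for concentrating solutions -/

namespace NLSSequence

variable {K : Constants} {γ : Trajectory} {N : Nonlinearity} {S : NLSSequence}
  {ψ : ℕ → ST → ℂ} {t₀ ρinf : ℝ}

/-- The total current in the ball `Ωₙ(t)`. -/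
def totalCurrent (K : Constants) (γ : Trajectory) (S : NLSSequence) (ψ : ℕ → ST → ℂ) (n : ℕ)
    (t : ℝ) : E3 := ∫ x in γ.ball (S.R n) t, S.J K γ ψ n (t, x)

/-- Mass times current is charge times momentum. -/
theorem totalMomentum_eq_smul_totalCurrent (hq : K.q ≠ 0) (n : ℕ) (t : ℝ) :
    S.totalMomentum K γ ψ n t = (K.m * K.q⁻¹) • S.totalCurrent K γ ψ n t := by
  have hm := K.m_pos.ne'
  rw [totalMomentum, totalCurrent, ← integral_smul]
  congr 1
  ext1 x
  rw [J, current_eq_smul_momentum, smul_smul, show K.m * K.q⁻¹ * (K.q / K.m) = 1 by field_simp,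
    one_smul]
  rfl

namespace Concentrates

theorem R_pos (h : S.Concentrates K γ N ψ t₀ ρinf) (n : ℕ) : 0 < S.R n := h.localized.R_pos n

theorem uniqueDiffOn (h : S.Concentrates K γ N ψ t₀ ρinf) (n : ℕ) :
    UniqueDiffOn ℝ (γ.tube (S.R n)) := γ.uniqueDiffOn_tube (h.R_pos n)

theorem contDiffOn_ρ (h : S.Concentrates K γ N ψ t₀ ρinf) (n : ℕ) :
    ContDiffOn ℝ 1 (ρ K ψ n) (γ.tube (S.R n)) :=
  contDiffOn_chargeDensity ((h.contDiffOn n).of_le (by norm_num))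

theorem contDiffOn_J (h : S.Concentrates K γ N ψ t₀ ρinf) (n : ℕ) :
    ContDiffOn ℝ 1 (S.J K γ ψ n) (γ.tube (S.R n)) :=
  contDiffOn_current (h.uniqueDiffOn n) (h.localized.A_contDiffOn n) (h.contDiffOn n)

theorem contDiffOn_P (h : S.Concentrates K γ N ψ t₀ ρinf) (n : ℕ) :
    ContDiffOn ℝ 1 (S.P K γ ψ n) (γ.tube (S.R n)) :=
  contDiffOn_momentum (h.uniqueDiffOn n) (h.localized.A_contDiffOn n) (h.contDiffOn n)

theorem contDiffOn_T (h : S.Concentrates K γ N ψ t₀ ρinf) (n : ℕ) (i j : Fin 3) :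
    ContDiffOn ℝ 1 (S.T K γ N ψ n i j) (γ.tube (S.R n)) :=
  contDiffOn_stress (h.uniqueDiffOn n) (h.localized.a_pos n) (h.localized.φ_contDiffOn n)
    (h.localized.A_contDiffOn n) (h.contDiffOn n) i j

theorem continuousOn_E (h : S.Concentrates K γ N ψ t₀ ρinf) (n : ℕ) :
    ContinuousOn (S.E K γ n) (γ.tube (S.R n)) := by
  have hφ := γ.continuousOn_dx (h.R_pos n) ((h.localized.φ_contDiffOn n).of_le (by norm_num))
  have hA := γ.continuousOn_dt (h.R_pos n) ((h.localized.A_contDiffOn n).of_le (by norm_num))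
  refine ContinuousOn.sub (ContinuousOn.neg ?_) (hA.const_smul K.c⁻¹)
  exact (PiLp.continuous_toLp 2 _).comp_continuousOn (continuousOn_pi.2 hφ)

theorem continuousOn_B (h : S.Concentrates K γ N ψ t₀ ρinf) (n : ℕ) :
    ContinuousOn (S.B γ n) (γ.tube (S.R n)) := by
  have hA : ∀ i j, ContinuousOn (fun p => dx (γ.tube (S.R n)) i (S.A n) p j) (γ.tube (S.R n)) :=
    fun i j => (EuclideanSpace.proj (𝕜 := ℝ) j).continuous.comp_continuousOn
      (γ.continuousOn_dx (h.R_pos n) ((h.localized.A_contDiffOn n).of_le (by norm_num)) i)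
  refine (PiLp.continuous_toLp 2 _).comp_continuousOn (continuousOn_pi.2 fun i => ?_)
  fin_cases i
  · exact (hA 1 2).sub (hA 2 1)
  · exact (hA 2 0).sub (hA 0 2)
  · exact (hA 0 1).sub (hA 1 0)

theorem bdryContinuous_vel_mul_ρ (h : S.Concentrates K γ N ψ t₀ ρinf) (n : ℕ) :
    γ.BdryContinuous (S.R n) fun t x ν => inner ℝ (γ.vel t) ν * ρ K ψ n (t, x) :=
  Trajectory.bdryContinuous_vel.smul
    (Trajectory.bdryContinuous_of_continuousOn (h.R_pos n) (h.contDiffOn_ρ n).continuousOn)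

theorem bdryContinuous_inner_J (h : S.Concentrates K γ N ψ t₀ ρinf) (n : ℕ) :
    γ.BdryContinuous (S.R n) fun t x ν => (inner ℝ ν (S.J K γ ψ n (t, x)) : ℝ) :=
  Trajectory.bdryContinuous_normal.inner
    (Trajectory.bdryContinuous_of_continuousOn (h.R_pos n) (h.contDiffOn_J n).continuousOn)

theorem hasDerivWithinAt_charge (h : S.Concentrates K γ N ψ t₀ ρinf) (n : ℕ) {t : ℝ}
    (ht : t ∈ γ.I) : HasDerivWithinAt (S.charge K γ ψ n)
      ((S.bdryIntegral γ n t fun x ν => inner ℝ (γ.vel t) ν * ρ K ψ n (t, x)) -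
        S.bdryIntegral γ n t fun x ν => inner ℝ ν (S.J K γ ψ n (t, x))) γ.I t := by
  refine (γ.hasDerivWithinAt_integral_ball (h.R_pos n) (h.contDiffOn_ρ n) ht).congr_deriv ?_
  have h1 := γ.setIntegral_divergence (h.R_pos n) (h.contDiffOn_J n) ht
  have h2 : ∫ x in γ.ball (S.R n) t, dt (γ.tube (S.R n)) (ρ K ψ n) (t, x) =
      -∫ x in γ.ball (S.R n) t,
        ∑ i : Fin 3, dx (γ.tube (S.R n)) i (fun p => S.J K γ ψ n p i) (t, x) := by
    rw [← integral_neg]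
    exact setIntegral_congr_fun (γ.measurableSet_ball t) fun x hx =>
      continuity_equation (h.uniqueDiffOn n) ⟨ht, hx⟩ (h.localized.A_contDiffOn n)
        (h.contDiffOn n) (h.solves n)
  rw [h2, h1, bdryIntegral, bdryIntegral]
  ring

/-- The charge in the ball changes only through the boundary terms `Q₂₃`. -/
theorem charge_eq (h : S.Concentrates K γ N ψ t₀ ρinf) (n : ℕ) {t : ℝ} (ht : t ∈ γ.I) :
    S.charge K γ ψ n t = S.charge K γ ψ n t₀ + S.Q23 K γ ψ t₀ n t := by
  have hsub : uIcc t₀ t ⊆ γ.I := uIcc_subset_Icc h.t₀_mem ht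
  have h1 := (h.bdryContinuous_vel_mul_ρ n).continuousOn_surfaceIntegral
  have h2 := (h.bdryContinuous_inner_J n).continuousOn_surfaceIntegral
  have h3 := γ.integral_eq_sub_of_hasDerivWithinAt
    (fun t ht => h.hasDerivWithinAt_charge n ht) (h1.sub h2) h.t₀_mem ht
  rw [Q23, ← intervalIntegral.integral_sub]
  · rw [h3]
    ring
  · exact (h1.mono hsub).intervalIntegrable
  · exact (h2.mono hsub).intervalIntegrable

theorem continuousOn_charge (h : S.Concentrates K γ N ψ t₀ ρinf) (n : ℕ) :
    ContinuousOn (S.charge K γ ψ n) γ.I :=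
  γ.continuousOn_integral_ball (h.contDiffOn_ρ n).continuousOn

theorem continuousOn_totalCurrent (h : S.Concentrates K γ N ψ t₀ ρinf) (n : ℕ) :
    ContinuousOn (S.totalCurrent K γ ψ n) γ.I :=
  γ.continuousOn_integral_ball (h.contDiffOn_J n).continuousOn

/-- The derivative of the first moment of the charge density. By the continuity equation
`∂ₜ(ρ xⱼ) = Jⱼ - ∇ · (xⱼ J)`, which gives the total current and a boundary term. -/
theorem hasDerivWithinAt_moment (h : S.Concentrates K γ N ψ t₀ ρinf) (n : ℕ) {t : ℝ}
    (ht : t ∈ γ.I) :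
    HasDerivWithinAt (fun t => ∫ x in γ.ball (S.R n) t, ρ K ψ n (t, x) • x)
      (S.totalCurrent K γ ψ n t +
        (S.bdryIntegral γ n t fun x ν => (inner ℝ (γ.vel t) ν * ρ K ψ n (t, x)) • x) -
        S.bdryIntegral γ n t fun x ν => (inner ℝ ν (S.J K γ ψ n (t, x)) : ℝ) • x) γ.I t := by
  have hR := h.R_pos n
  have hu := h.uniqueDiffOn n
  have hx : ContDiffOn ℝ 1 (fun p : ST => p.2) (γ.tube (S.R n)) := contDiff_snd.contDiffOn
  have hxj : ∀ j, ContDiffOn ℝ 1 (fun p : ST => p.2 j) (γ.tube (S.R n)) := contDiffOn_coord hx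
  have hf : ContDiffOn ℝ 1 (fun p : ST => ρ K ψ n p • p.2) (γ.tube (S.R n)) :=
    (h.contDiffOn_ρ n).smul hx
  refine (γ.hasDerivWithinAt_integral_ball_vector hR hf ht).congr_deriv ?_
  have hJ := h.contDiffOn_J n
  have hb : γ.BdryContinuous (S.R n) fun t x ν => (inner ℝ ν (S.J K γ ψ n (t, x)) : ℝ) • x :=
    (h.bdryContinuous_inner_J n).smul
      (Trajectory.bdryContinuous_of_continuousOn hR hx.continuousOn)
  have key : ∫ x in γ.ball (S.R n) t, dt (γ.tube (S.R n)) (fun p => ρ K ψ n p • p.2) (t, x) =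
      S.totalCurrent K γ ψ n t -
        S.bdryIntegral γ n t fun x ν => (inner ℝ ν (S.J K γ ψ n (t, x)) : ℝ) • x := by
    ext j
    rw [γ.integral_ball_apply (γ.continuousOn_dt hR hf) ht, PiLp.sub_apply, totalCurrent,
      γ.integral_ball_apply hJ.continuousOn ht, bdryIntegral,
      Trajectory.surfaceIntegral_apply hb ht]
    have hxJ : ContDiffOn ℝ 1 (fun p : ST => p.2 j • S.J K γ ψ n p) (γ.tube (S.R n)) :=
      (hxj j).smul hJ
    have hdiv := γ.setIntegral_divergence hR hxJ ht
    have hpt : ∀ x ∈ γ.ball (S.R n) t,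
        dt (γ.tube (S.R n)) (fun p => ρ K ψ n p • p.2) (t, x) j =
          S.J K γ ψ n (t, x) j - ∑ i : Fin 3,
            dx (γ.tube (S.R n)) i (fun p => (p.2 j • S.J K γ ψ n p) i) (t, x) := by
      intro x hx'
      have hp : (t, x) ∈ γ.tube (S.R n) := ⟨ht, hx'⟩
      have hup := hu _ hp
      have hcont := continuity_equation hu hp (h.localized.A_contDiffOn n)
        (h.contDiffOn n) (h.solves n)
      have h1 : dt (γ.tube (S.R n)) (fun p => ρ K ψ n p • p.2) (t, x) j =
          x j * dt (γ.tube (S.R n)) (ρ K ψ n) (t, x) := by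
        have := congrArg (fun L => L (1, 0) j)
          (((hasFDerivWithinAt_of_contDiffOn_one (h.contDiffOn_ρ n) hp).smul
            hasFDerivWithinAt_snd).fderivWithin hup)
        refine this.trans ?_
        simp [dt, mul_comm]
      have h2 : ∀ i, dx (γ.tube (S.R n)) i (fun p => (p.2 j • S.J K γ ψ n p) i) (t, x) =
          x j * dx (γ.tube (S.R n)) i (fun p => S.J K γ ψ n p i) (t, x) +
            if i = j then S.J K γ ψ n (t, x) i else 0 := by
        intro i
        have hd2 : HasFDerivWithinAt (fun p : ST => p.2 j)
            ((EuclideanSpace.proj (𝕜 := ℝ) j).comp (ContinuousLinearMap.snd ℝ ℝ E3))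
            (γ.tube (S.R n)) (t, x) :=
          (EuclideanSpace.proj (𝕜 := ℝ) j).hasFDerivAt.comp_hasFDerivWithinAt _
            hasFDerivWithinAt_snd
        have := congrArg (fun L => L (dirX i)) ((hd2.mul
          (hasFDerivWithinAt_of_contDiffOn_one (contDiffOn_coord hJ i) hp)).fderivWithin hup)
        refine this.trans ?_
        by_cases hij : i = j
        · subst hij
          simp [dx]
        · simp [dx, hij, Ne.symm hij]
      rw [h1, show dt (γ.tube (S.R n)) (ρ K ψ n) (t, x) = _ from hcont]
      simp_rw [h2]
      rw [Finset.sum_add_distrib, Finset.sum_ite_eq' Finset.univ j, if_pos (Finset.mem_univ j),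
        ← Finset.mul_sum]
      simp only [J, tube]
      ring
    rw [setIntegral_congr_fun (γ.measurableSet_ball t) hpt, integral_sub, hdiv]
    · congr 2
      ext x ν
      simp [inner_smul_right, mul_comm]
    · exact γ.integrableOn_slice (contDiffOn_coord hJ j).continuousOn ht
    · exact γ.integrableOn_slice (f := fun p => ∑ i : Fin 3,
        dx (γ.tube (S.R n)) i (fun p => (p.2 j • S.J K γ ψ n p) i) p)
        (continuousOn_finsetSum _ fun i _ =>
          γ.continuousOn_dx hR (contDiffOn_coord hxJ i) i) ht
  rw [key, bdryIntegral, bdryIntegral]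
  simp_rw [smul_smul]
  abel

theorem bdryContinuous_T (h : S.Concentrates K γ N ψ t₀ ρinf) (n : ℕ) :
    γ.BdryContinuous (S.R n) fun t x ν =>
      (WithLp.toLp 2 fun j : Fin 3 => ∑ i : Fin 3, ν i * S.T K γ N ψ n i j (t, x) : E3) :=
  (PiLp.continuous_toLp 2 _).comp_continuousOn (continuousOn_pi.2 fun j =>
    continuousOn_finsetSum _ fun i _ => ContinuousOn.mul (Continuous.continuousOn (by fun_prop))
      (γ.continuousOn_sphere_param (h.R_pos n) (h.contDiffOn_T n i j).continuousOn))

theorem bdryContinuous_vel_smul_P (h : S.Concentrates K γ N ψ t₀ ρinf) (n : ℕ) :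
    γ.BdryContinuous (S.R n) fun t x ν => (inner ℝ (γ.vel t) ν : ℝ) • S.P K γ ψ n (t, x) :=
  Trajectory.bdryContinuous_vel.smul
    (Trajectory.bdryContinuous_of_continuousOn (h.R_pos n) (h.contDiffOn_P n).continuousOn)

theorem continuousOn_force (h : S.Concentrates K γ N ψ t₀ ρinf) (n : ℕ) :
    ContinuousOn (fun p => ρ K ψ n p • S.E K γ n p +
      cross (K.c⁻¹ • S.J K γ ψ n p) (S.B γ n p)) (γ.tube (S.R n)) := by
  have h1 : ContinuousOn (fun p => K.c⁻¹ • S.J K γ ψ n p) (γ.tube (S.R n)) :=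
    (h.contDiffOn_J n).continuousOn.const_smul K.c⁻¹
  have h2 : ContinuousOn (fun p => ρ K ψ n p • S.E K γ n p) (γ.tube (S.R n)) :=
    (h.contDiffOn_ρ n).continuousOn.smul (h.continuousOn_E n)
  exact h2.add (h1.cross (h.continuousOn_B n))

/-- The total momentum changes by the stress and transport through the boundary and by the Lorentz
force in the ball. -/
theorem hasDerivWithinAt_totalMomentum (h : S.Concentrates K γ N ψ t₀ ρinf) (n : ℕ) {t : ℝ}
    (ht : t ∈ γ.I) :
    HasDerivWithinAt (S.totalMomentum K γ ψ n)
      ((S.bdryIntegral γ n t fun x ν =>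
          (WithLp.toLp 2 fun j : Fin 3 => ∑ i : Fin 3, ν i * S.T K γ N ψ n i j (t, x) : E3)) +
        (S.bdryIntegral γ n t fun x ν => (inner ℝ (γ.vel t) ν : ℝ) • S.P K γ ψ n (t, x)) +
        ∫ x in γ.ball (S.R n) t, (ρ K ψ n (t, x) • S.E K γ n (t, x) +
          cross (K.c⁻¹ • S.J K γ ψ n (t, x)) (S.B γ n (t, x)))) γ.I t := by
  have hR := h.R_pos n
  have hu := h.uniqueDiffOn n
  have hP := h.contDiffOn_P n
  have hF := h.continuousOn_force n
  refine (γ.hasDerivWithinAt_integral_ball_vector hR hP ht).congr_deriv ?_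
  have key : ∫ x in γ.ball (S.R n) t, dt (γ.tube (S.R n)) (S.P K γ ψ n) (t, x) =
      (S.bdryIntegral γ n t fun x ν =>
          (WithLp.toLp 2 fun j : Fin 3 => ∑ i : Fin 3, ν i * S.T K γ N ψ n i j (t, x) : E3)) +
        ∫ x in γ.ball (S.R n) t, (ρ K ψ n (t, x) • S.E K γ n (t, x) +
          cross (K.c⁻¹ • S.J K γ ψ n (t, x)) (S.B γ n (t, x))) := by
    ext j
    rw [γ.integral_ball_apply (γ.continuousOn_dt hR hP) ht, PiLp.add_apply,
      γ.integral_ball_apply hF ht, bdryIntegral,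
      Trajectory.surfaceIntegral_apply (h.bdryContinuous_T n) ht]
    have hT : ContDiffOn ℝ 1 (fun p => (WithLp.toLp 2 fun i => S.T K γ N ψ n i j p : E3))
        (γ.tube (S.R n)) := contDiffOn_euclidean.2 fun i => h.contDiffOn_T n i j
    have hdiv := γ.setIntegral_divergence hR hT ht
    have hpt : ∀ x ∈ γ.ball (S.R n) t, dt (γ.tube (S.R n)) (S.P K γ ψ n) (t, x) j =
        (∑ i : Fin 3, dx (γ.tube (S.R n)) i (S.T K γ N ψ n i j) (t, x)) +
          (ρ K ψ n (t, x) • S.E K γ n (t, x) +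
            cross (K.c⁻¹ • S.J K γ ψ n (t, x)) (S.B γ n (t, x))) j := by
      intro x hx
      have hp : (t, x) ∈ γ.tube (S.R n) := ⟨ht, hx⟩
      refine Eq.trans ?_ (momentum_equation hu (γ.tube_subset_closure_interior hR) hp
        (h.localized.a_pos n) (h.localized.φ_contDiffOn n) (h.localized.A_contDiffOn n)
        (h.contDiffOn n) (h.solves n) j)
      exact (fderivWithin_coord (hu _ hp) (hP.differentiableOn one_ne_zero _ hp) j _).symm
    rw [setIntegral_congr_fun (γ.measurableSet_ball t) hpt, integral_add]
    · congr 1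
      refine hdiv.trans ?_
      congr 1
      ext x ν
      simp [PiLp.inner_apply, mul_comm]
    · exact γ.integrableOn_slice (f := fun p => ∑ i : Fin 3,
        dx (γ.tube (S.R n)) i (S.T K γ N ψ n i j) p)
        (continuousOn_finsetSum _ fun i _ => γ.continuousOn_dx hR (h.contDiffOn_T n i j) i) ht
    · exact γ.integrableOn_slice (f := fun p => (ρ K ψ n p • S.E K γ n p +
        cross (K.c⁻¹ • S.J K γ ψ n p) (S.B γ n p)) j)
        ((EuclideanSpace.proj (𝕜 := ℝ) j).continuous.comp_continuousOn hF) ht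
  rw [key, bdryIntegral, bdryIntegral]
  abel

/-- The Lorentz force in the ball, compared with the limit fields at the trajectory. -/
theorem integral_force_eq (h : S.Concentrates K γ N ψ t₀ ρinf) (n : ℕ) {t : ℝ} (ht : t ∈ γ.I) :
    ∫ x in γ.ball (S.R n) t, (ρ K ψ n (t, x) • S.E K γ n (t, x) +
        cross (K.c⁻¹ • S.J K γ ψ n (t, x)) (S.B γ n (t, x))) =
      (S.Q30 K γ ψ n t + S.Q31 K γ ψ n t) + (S.charge K γ ψ n t • S.Elim K γ t +
        cross (S.totalCurrent K γ ψ n t) (K.c⁻¹ • S.Blim γ t)) := by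
  have hρ := (h.contDiffOn_ρ n).continuousOn
  have hJ := (h.contDiffOn_J n).continuousOn
  have hJc : ContinuousOn (fun p => K.c⁻¹ • S.J K γ ψ n p) (γ.tube (S.R n)) :=
    hJ.const_smul K.c⁻¹
  have hi1 := γ.integrableOn_slice (f := fun p => ρ K ψ n p • (S.E K γ n p - S.Elim K γ t))
    (hρ.smul ((h.continuousOn_E n).sub continuousOn_const)) ht
  have hi2 := γ.integrableOn_slice
    (f := fun p => cross (K.c⁻¹ • S.J K γ ψ n p) (S.B γ n p - S.Blim γ t))
    (hJc.cross ((h.continuousOn_B n).sub continuousOn_const)) ht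
  have hi3 := γ.integrableOn_slice (f := fun p => ρ K ψ n p • S.Elim K γ t)
    (hρ.smul continuousOn_const) ht
  have hi4 := γ.integrableOn_slice (f := fun p => cross (S.J K γ ψ n p) (K.c⁻¹ • S.Blim γ t))
    (hJ.cross continuousOn_const) ht
  have h3 : S.charge K γ ψ n t • S.Elim K γ t =
      ∫ x in γ.ball (S.R n) t, ρ K ψ n (t, x) • S.Elim K γ t := (integral_smul_const _ _).symm
  have h4 : cross (S.totalCurrent K γ ψ n t) (K.c⁻¹ • S.Blim γ t) =
      ∫ x in γ.ball (S.R n) t, cross (S.J K γ ψ n (t, x)) (K.c⁻¹ • S.Blim γ t) :=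
    ((crossL.flip (K.c⁻¹ • S.Blim γ t)).integral_comp_comm (γ.integrableOn_slice hJ ht)).symm
  have hi12 : Integrable (fun x => ρ K ψ n (t, x) • (S.E K γ n (t, x) - S.Elim K γ t) +
      cross (K.c⁻¹ • S.J K γ ψ n (t, x)) (S.B γ n (t, x) - S.Blim γ t))
      (volume.restrict (γ.ball (S.R n) t)) := hi1.add hi2
  have hi34 : Integrable (fun x => ρ K ψ n (t, x) • S.Elim K γ t +
      cross (S.J K γ ψ n (t, x)) (K.c⁻¹ • S.Blim γ t))
      (volume.restrict (γ.ball (S.R n) t)) := hi3.add hi4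
  rw [h3, h4, Q30, Q31, ← integral_add hi1 hi2, ← integral_add hi3 hi4, ← integral_add hi12 hi34]
  congr 1
  ext1 x
  simp only [smul_sub, ← crossL_apply, map_sub, map_smul, _root_.smul_apply]
  abel

/-- The momentum balance integrated in time. -/
theorem totalMomentum_eq (h : S.Concentrates K γ N ψ t₀ ρinf) (n : ℕ)
    (hE : ContinuousOn (S.Elim K γ) γ.I) (hB : ContinuousOn (S.Blim γ) γ.I) {t : ℝ}
    (ht : t ∈ γ.I) :
    S.totalMomentum K γ ψ n t = S.totalMomentum K γ ψ n t₀ + S.Q0 K γ N ψ t₀ n t +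
      S.Q01 K γ ψ t₀ n t + (∫ τ in t₀..t, (S.Q30 K γ ψ n τ + S.Q31 K γ ψ n τ)) +
      ∫ τ in t₀..t, (S.charge K γ ψ n τ • S.Elim K γ τ +
        cross (S.totalCurrent K γ ψ n τ) (K.c⁻¹ • S.Blim γ τ)) := by
  have hsub : uIcc t₀ t ⊆ γ.I := uIcc_subset_Icc h.t₀_mem ht
  have h1 := (h.bdryContinuous_T n).continuousOn_surfaceIntegral
  have h2 := (h.bdryContinuous_vel_smul_P n).continuousOn_surfaceIntegral
  have h3 := γ.continuousOn_integral_ball (h.continuousOn_force n)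
  have h5 : ContinuousOn (fun τ => S.charge K γ ψ n τ • S.Elim K γ τ +
      cross (S.totalCurrent K γ ψ n τ) (K.c⁻¹ • S.Blim γ τ)) γ.I :=
    ((h.continuousOn_charge n).smul hE).add
      ((h.continuousOn_totalCurrent n).cross (hB.const_smul K.c⁻¹))
  have h4 : ContinuousOn (fun τ => S.Q30 K γ ψ n τ + S.Q31 K γ ψ n τ) γ.I :=
    (h3.sub h5).congr fun τ hτ => by
      simp only [Pi.sub_apply]
      rw [h.integral_force_eq n hτ]
      abel
  have hftc := γ.integral_eq_sub_of_hasDerivWithinAt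
    (fun t ht => h.hasDerivWithinAt_totalMomentum n ht) ((h1.add h2).add h3) h.t₀_mem ht
  have hint : ∀ {f : ℝ → E3}, ContinuousOn f γ.I → IntervalIntegrable f volume t₀ t := fun hf =>
    (hf.mono hsub).intervalIntegrable
  have hadd : ∀ {f g : ℝ → E3}, ContinuousOn f γ.I → ContinuousOn g γ.I →
      ∫ τ in t₀..t, (f τ + g τ) = (∫ τ in t₀..t, f τ) + ∫ τ in t₀..t, g τ := fun hf hg =>
    intervalIntegral.integral_add (hint hf) (hint hg)
  have hforce := (intervalIntegral.integral_congr fun τ hτ =>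
    h.integral_force_eq n (hsub hτ)).trans (hadd h4 h5)
  have hsum := hftc.symm.trans ((hadd (h1.add h2) h3).trans
    (congrArg₂ (· + ·) (hadd h1 h2) hforce))
  rw [sub_eq_iff_eq_add] at hsum
  rw [hsum, Q0, Q01]
  simp only [bdryIntegral]
  abel

/-! ### The adjacent charge centers -/

theorem continuousOn_moment (h : S.Concentrates K γ N ψ t₀ ρinf) (n : ℕ) :
    ContinuousOn (fun t => ∫ x in γ.ball (S.R n) t, ρ K ψ n (t, x) • x) γ.I := fun _ ht =>
  (h.hasDerivWithinAt_moment n ht).continuousWithinAt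

theorem continuousOn_center (h : S.Concentrates K γ N ψ t₀ ρinf) {n : ℕ}
    (hpos : ∀ t ∈ γ.I, 0 < S.charge K γ ψ n t) : ContinuousOn (S.center K γ ψ n) γ.I :=
  ((h.continuousOn_charge n).inv₀ fun t ht => (hpos t ht).ne').smul (h.continuousOn_moment n)

theorem Q20_eq (h : S.Concentrates K γ N ψ t₀ ρinf) (n : ℕ) {t : ℝ} (ht : t ∈ γ.I) :
    S.Q20 K γ ψ n t =
      -((surfaceIntegral (γ.pos t) (S.R n) fun x ν =>
          (inner ℝ (γ.vel t) ν * ρ K ψ n (t, x)) • x) -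
        (surfaceIntegral (γ.pos t) (S.R n) fun x ν => inner ℝ (γ.vel t) ν * ρ K ψ n (t, x)) •
          S.center K γ ψ n t) := by
  rw [Q20, bdryIntegral, Trajectory.surfaceIntegral_smul_sub (h.bdryContinuous_vel_mul_ρ n) ht]

theorem Q22_eq (h : S.Concentrates K γ N ψ t₀ ρinf) (n : ℕ) {t : ℝ} (ht : t ∈ γ.I) :
    S.Q22 K γ ψ n t =
      (surfaceIntegral (γ.pos t) (S.R n) fun x ν =>
          (inner ℝ ν (S.J K γ ψ n (t, x)) : ℝ) • x) -
        (surfaceIntegral (γ.pos t) (S.R n) fun x ν => inner ℝ ν (S.J K γ ψ n (t, x))) •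
          S.center K γ ψ n t := by
  rw [Q22, bdryIntegral, Trajectory.surfaceIntegral_smul_sub (h.bdryContinuous_inner_J n) ht]

/-- The velocity of the center is the mean current per charge, up to boundary terms which involve
`x` only through `x - rₙ`. -/
theorem hasDerivWithinAt_center (h : S.Concentrates K γ N ψ t₀ ρinf) {n : ℕ}
    (hpos : ∀ t ∈ γ.I, 0 < S.charge K γ ψ n t) {t : ℝ} (ht : t ∈ γ.I) :
    HasDerivWithinAt (S.center K γ ψ n) ((S.charge K γ ψ n t)⁻¹ •
      (S.totalCurrent K γ ψ n t - S.Q20 K γ ψ n t - S.Q22 K γ ψ n t)) γ.I t := by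
  have hne := (hpos t ht).ne'
  refine (((h.hasDerivWithinAt_charge n ht).inv hne).smul
    (h.hasDerivWithinAt_moment n ht)).congr_deriv ?_
  rw [h.Q20_eq n ht, h.Q22_eq n ht, center, Pi.inv_apply]
  simp only [bdryIntegral]
  module

theorem continuousOn_Q20 (h : S.Concentrates K γ N ψ t₀ ρinf) {n : ℕ}
    (hpos : ∀ t ∈ γ.I, 0 < S.charge K γ ψ n t) : ContinuousOn (S.Q20 K γ ψ n) γ.I := by
  have hx : γ.BdryContinuous (S.R n) fun _ x _ => x :=
    Trajectory.bdryContinuous_of_continuousOn (h.R_pos n) continuousOn_snd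
  have h1 := h.bdryContinuous_vel_mul_ρ n
  exact (((h1.smul hx).continuousOn_surfaceIntegral).sub
    (h1.continuousOn_surfaceIntegral.smul (h.continuousOn_center hpos))).neg.congr
      fun t ht => h.Q20_eq n ht

theorem continuousOn_Q22 (h : S.Concentrates K γ N ψ t₀ ρinf) {n : ℕ}
    (hpos : ∀ t ∈ γ.I, 0 < S.charge K γ ψ n t) : ContinuousOn (S.Q22 K γ ψ n) γ.I := by
  have hx : γ.BdryContinuous (S.R n) fun _ x _ => x :=
    Trajectory.bdryContinuous_of_continuousOn (h.R_pos n) continuousOn_snd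
  have h1 := h.bdryContinuous_inner_J n
  exact (((h1.smul hx).continuousOn_surfaceIntegral).sub
    (h1.continuousOn_surfaceIntegral.smul (h.continuousOn_center hpos))).congr
      fun t ht => h.Q22_eq n ht

/-- The total current is the charge times the velocity of the center, up to boundary terms. -/
theorem totalCurrent_eq (h : S.Concentrates K γ N ψ t₀ ρinf) {n : ℕ}
    (hpos : ∀ t ∈ γ.I, 0 < S.charge K γ ψ n t) {t : ℝ} (ht : t ∈ γ.I) :
    S.totalCurrent K γ ψ n t = S.charge K γ ψ n t • S.centerVel K γ ψ n t +
      S.Q20 K γ ψ n t + S.Q22 K γ ψ n t := by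
  rw [centerVel, (h.hasDerivWithinAt_center hpos ht).derivWithin (γ.uniqueDiffOn_I t ht),
    smul_inv_smul₀ (hpos t ht).ne']
  abel

theorem continuousOn_centerVel (h : S.Concentrates K γ N ψ t₀ ρinf) {n : ℕ}
    (hpos : ∀ t ∈ γ.I, 0 < S.charge K γ ψ n t) : ContinuousOn (S.centerVel K γ ψ n) γ.I := by
  refine ContinuousOn.congr ?_ fun t ht =>
    (h.hasDerivWithinAt_center hpos ht).derivWithin (γ.uniqueDiffOn_I t ht)
  exact ((h.continuousOn_charge n).inv₀ fun t ht => (hpos t ht).ne').smul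
    (((h.continuousOn_totalCurrent n).sub (h.continuousOn_Q20 hpos)).sub
      (h.continuousOn_Q22 hpos))

theorem contDiffOn_center (h : S.Concentrates K γ N ψ t₀ ρinf) {n : ℕ}
    (hpos : ∀ t ∈ γ.I, 0 < S.charge K γ ψ n t) : ContDiffOn ℝ 1 (S.center K γ ψ n) γ.I :=
  (contDiffOn_one_iff_derivWithin γ.uniqueDiffOn_I).2
    ⟨fun _ ht => (h.hasDerivWithinAt_center hpos ht).differentiableWithinAt,
      h.continuousOn_centerVel hpos⟩

/-- The center lies in the ball, since the charge density does not change sign. -/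
theorem norm_center_sub_le (h : S.Concentrates K γ N ψ t₀ ρinf) {n : ℕ}
    (hq : 0 < K.q) {t : ℝ} (ht : t ∈ γ.I) (hpos : 0 < S.charge K γ ψ n t) :
    ‖S.center K γ ψ n t - γ.pos t‖ ≤ S.R n := by
  have hρ := (h.contDiffOn_ρ n).continuousOn
  have hi := γ.integrableOn_slice hρ ht
  have hix := γ.integrableOn_slice (f := fun p => ρ K ψ n p • p.2) (hρ.smul continuousOn_snd) ht
  have h1 : S.center K γ ψ n t - γ.pos t = (S.charge K γ ψ n t)⁻¹ •
      ∫ x in γ.ball (S.R n) t, ρ K ψ n (t, x) • (x - γ.pos t) := by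
    simp_rw [smul_sub]
    rw [integral_sub hix (hi.smul_const _), integral_smul_const, smul_sub, center]
    congr 1
    exact (inv_smul_smul₀ hpos.ne' _).symm
  have h2 : ‖∫ x in γ.ball (S.R n) t, ρ K ψ n (t, x) • (x - γ.pos t)‖ ≤
      ∫ x in γ.ball (S.R n) t, ρ K ψ n (t, x) * S.R n := by
    refine norm_integral_le_of_norm_le (hi.mul_const _) ?_
    filter_upwards [ae_restrict_mem (γ.measurableSet_ball t)] with x hx
    have h0 : 0 ≤ ρ K ψ n (t, x) := mul_nonneg hq.le (Complex.normSq_nonneg _)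
    rw [norm_smul, Real.norm_eq_abs, abs_of_nonneg h0]
    exact mul_le_mul_of_nonneg_left (by simpa [dist_eq_norm] using Metric.mem_closedBall.1 hx) h0
  rw [h1, norm_smul, norm_inv, Real.norm_eq_abs, abs_of_pos hpos, inv_mul_le_iff₀ hpos]
  exact h2.trans_eq (integral_mul_const _ _)

/-! ### Continuity of the limit fields -/

theorem continuousOn_traj {V : Type*} [TopologicalSpace V] (h : S.Concentrates K γ N ψ t₀ ρinf)
    {n : ℕ} {f : ST → V} (hf : ContinuousOn f (γ.tube (S.R n))) :
    ContinuousOn (fun t => f (t, γ.pos t)) γ.I :=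
  hf.comp (continuousOn_id.prodMk γ.continuousOn_pos) fun _ ht =>
    ⟨ht, Metric.mem_closedBall_self (h.R_pos n).le⟩

theorem norm_dx_sub_le {V : Type*} [NormedAddCommGroup V] [NormedSpace ℝ V] {c : ℝ} {D D' : Set ST}
    {F F' : ST → V} {p : ST} (i : Fin 3) :
    ‖dx D i F p - dx D' i F' p‖ ≤ ‖grad0 c D F p - grad0 c D' F' p‖ :=
  PiLp.norm_apply_le (grad0 c D F p - grad0 c D' F' p) i.succ

theorem norm_dt_sub_le {V : Type*} [NormedAddCommGroup V] [NormedSpace ℝ V] {c : ℝ} {D D' : Set ST}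
    {F F' : ST → V} {p : ST} :
    ‖c⁻¹ • dt D F p - c⁻¹ • dt D' F' p‖ ≤ ‖grad0 c D F p - grad0 c D' F' p‖ :=
  PiLp.norm_apply_le (grad0 c D F p - grad0 c D' F' p) 0

/-- `E_∞` is the uniform limit of the continuous fields `Eₙ(t, r̂(t))`; its coefficients are only
assumed differentiable in time, so continuity cannot be read off from its definition. -/
theorem continuousOn_Elim (h : S.Concentrates K γ N ψ t₀ ρinf) :
    ContinuousOn (S.Elim K γ) γ.I := by
  suffices hj : ∀ j, ContinuousOn (fun t => S.Elim K γ t j) γ.I from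
    (PiLp.continuous_toLp 2 _).comp_continuousOn (continuousOn_pi.2 hj)
  intro j
  have hu : TendstoUniformlyOn (fun n t => S.E K γ n (t, γ.pos t) j) (fun t => S.Elim K γ t j)
      atTop γ.I := by
    rw [Metric.tendstoUniformlyOn_iff]
    intro ε hε
    filter_upwards [h.localized.φ_tendsto (ε / 3) (by positivity),
      h.localized.A_tendsto (ε / 3) (by positivity)] with n hφ hA t ht
    have hp : (t, γ.pos t) ∈ S.tube γ n := ⟨ht, Metric.mem_closedBall_self (h.R_pos n).le⟩
    have h1 := (norm_dx_sub_le (c := K.c) (D := S.tube γ n) (D' := γ.slab) (F := S.φ n)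
      (F' := S.φlim γ) (p := (t, γ.pos t)) j).trans
        ((le_add_of_nonneg_left (abs_nonneg _)).trans (hφ _ hp))
    have h2 := (PiLp.norm_apply_le _ j).trans ((norm_dt_sub_le (c := K.c) (D := S.tube γ n)
      (D' := γ.slab) (F := S.A n) (F' := S.Alim γ) (p := (t, γ.pos t))).trans
        ((le_add_of_nonneg_left (norm_nonneg _)).trans (hA _ hp)))
    rw [dist_comm, Real.dist_eq]
    simp only [E, Elim, electric, grad, PiLp.sub_apply, PiLp.neg_apply, PiLp.smul_apply] at h2 ⊢
    rw [Real.norm_eq_abs, abs_le] at h1 h2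
    rw [abs_lt]
    constructor <;> linarith [h1.1, h1.2, h2.1, h2.2]
  refine hu.continuousOn (Eventually.of_forall fun n => ?_).frequently
  exact (EuclideanSpace.proj (𝕜 := ℝ) j).continuous.comp_continuousOn
    (h.continuousOn_traj (h.continuousOn_E n))

/-- `B_∞` is the uniform limit of the continuous fields `Bₙ(t, r̂(t))`. -/
theorem continuousOn_Blim (h : S.Concentrates K γ N ψ t₀ ρinf) :
    ContinuousOn (S.Blim γ) γ.I := by
  suffices hj : ∀ j, ContinuousOn (fun t => S.Blim γ t j) γ.I from
    (PiLp.continuous_toLp 2 _).comp_continuousOn (continuousOn_pi.2 hj)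
  intro j
  have hu : TendstoUniformlyOn (fun n t => S.B γ n (t, γ.pos t) j) (fun t => S.Blim γ t j)
      atTop γ.I := by
    rw [Metric.tendstoUniformlyOn_iff]
    intro ε hε
    filter_upwards [h.localized.A_tendsto (ε / 3) (by positivity)] with n hA t ht
    have hp : (t, γ.pos t) ∈ S.tube γ n := ⟨ht, Metric.mem_closedBall_self (h.R_pos n).le⟩
    have h2 : ∀ i k, |dx (S.tube γ n) i (S.A n) (t, γ.pos t) k -
        dx γ.slab i (S.Alim γ) (t, γ.pos t) k| ≤ ε / 3 := fun i k =>
      (PiLp.norm_apply_le _ k).trans ((norm_dx_sub_le (c := K.c) (D := S.tube γ n)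
        (D' := γ.slab) (F := S.A n) (F' := S.Alim γ) (p := (t, γ.pos t)) i).trans
          ((le_add_of_nonneg_left (norm_nonneg _)).trans (hA _ hp)))
    have h3 : ∀ i k, |(dx (S.tube γ n) i (S.A n) (t, γ.pos t) k -
        dx (S.tube γ n) k (S.A n) (t, γ.pos t) i) - (dx γ.slab i (S.Alim γ) (t, γ.pos t) k -
          dx γ.slab k (S.Alim γ) (t, γ.pos t) i)| < ε := fun i k => by
      have h4 := abs_le.1 (h2 i k)
      have h5 := abs_le.1 (h2 k i)
      rw [abs_lt]
      constructor <;> linarith [h4.1, h4.2, h5.1, h5.2]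
    rw [dist_comm, Real.dist_eq]
    fin_cases j
    · exact h3 1 2
    · exact h3 2 0
    · exact h3 0 1
  refine hu.continuousOn (Eventually.of_forall fun n => ?_).frequently
  exact (EuclideanSpace.proj (𝕜 := ℝ) j).continuous.comp_continuousOn
    (h.continuousOn_traj (h.continuousOn_B n))

end Concentrates

end NLSSequence

/-! ### Uniformly small sequences -/

/-- A sequence of functions of time which tends to `0` uniformly on `s`. -/
def UniformlySmall {V : Type*} [NormedAddCommGroup V] (s : Set ℝ) (f : ℕ → ℝ → V) : Prop :=
  ∀ ε > 0, ∀ᶠ n in atTop, ∀ t ∈ s, ‖f n t‖ ≤ ε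

section UniformlySmall

variable {V : Type*} [NormedAddCommGroup V] {s : Set ℝ} {f g : ℕ → ℝ → V}

theorem uniformlySmall_iff :
    UniformlySmall s f ↔ TendstoUniformlyOn f (fun _ => 0) atTop s := by
  rw [Metric.tendstoUniformlyOn_iff]
  constructor
  · intro h ε hε
    filter_upwards [h (ε / 2) (by positivity)] with n hn t ht
    rw [dist_zero_left]
    linarith [hn t ht]
  · intro h ε hε
    filter_upwards [h ε hε] with n hn t ht
    simpa using (hn t ht).le

theorem UniformlySmall.add (hf : UniformlySmall s f) (hg : UniformlySmall s g) :
    UniformlySmall s fun n t => f n t + g n t := by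
  intro ε hε
  filter_upwards [hf (ε / 2) (by positivity), hg (ε / 2) (by positivity)] with n h1 h2 t ht
  linarith [norm_add_le (f n t) (g n t), h1 t ht, h2 t ht]

theorem UniformlySmall.congr (hf : UniformlySmall s f)
    (h : ∀ᶠ n in atTop, ∀ t ∈ s, g n t = f n t) : UniformlySmall s g := by
  intro ε hε
  filter_upwards [hf ε hε, h] with n h1 h2 t ht
  rw [h2 t ht]
  exact h1 t ht

/-- Smallness is preserved by operations which are bounded by a fixed multiple of the argument. -/
theorem UniformlySmall.of_norm_le {W : Type*} [NormedAddCommGroup W] {k : ℕ → ℝ → W} {C : ℝ}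
    (hf : UniformlySmall s f) (h : ∀ᶠ n in atTop, ∀ t ∈ s, ‖k n t‖ ≤ C * ‖f n t‖) :
    UniformlySmall s k := by
  intro ε hε
  have hC : 0 < |C| + 1 := by positivity
  filter_upwards [hf (ε / (|C| + 1)) (by positivity), h] with n h1 h2 t ht
  calc ‖k n t‖ ≤ C * ‖f n t‖ := h2 t ht
    _ ≤ (|C| + 1) * ‖f n t‖ := by
      gcongr
      linarith [le_abs_self C]
    _ ≤ (|C| + 1) * (ε / (|C| + 1)) := by gcongr; exact h1 t ht
    _ = ε := by field_simp

theorem UniformlySmall.comp (hf : UniformlySmall s f) {k : ℕ → ℕ} (hk : StrictMono k) :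
    UniformlySmall s fun j => f (k j) := fun ε hε =>
  hk.tendsto_atTop.eventually (hf ε hε)

theorem uniformlySmall_const {x : ℕ → V} (hx : Tendsto x atTop (𝓝 0)) :
    UniformlySmall s fun n _ => x n := fun ε hε => by
  filter_upwards [(tendsto_zero_iff_norm_tendsto_zero.1 hx).eventually (ge_mem_nhds hε)]
    with n hn t _ using hn

theorem UniformlySmall.integral [NormedSpace ℝ V] {a b t₀ : ℝ}
    (hf : UniformlySmall (Icc a b) f) (ht₀ : t₀ ∈ Icc a b) :
    UniformlySmall (Icc a b) fun n t => ∫ τ in t₀..t, f n τ := by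
  intro ε hε
  have hab : 0 < b - a + 1 := by linarith [ht₀.1.trans ht₀.2]
  filter_upwards [hf (ε / (b - a + 1)) (by positivity)] with n hn t ht
  have h1 := intervalIntegral.norm_integral_le_of_norm_le_const (a := t₀) (b := t) (f := f n)
    (C := ε / (b - a + 1))
    fun τ hτ => hn τ (uIcc_subset_Icc ht₀ ht (uIoc_subset_uIcc hτ))
  have h2 : |t - t₀| ≤ b - a + 1 := by
    rw [abs_le]
    constructor <;> linarith [ht.1, ht.2, ht₀.1, ht₀.2]
  calc _ ≤ ε / (b - a + 1) * |t - t₀| := h1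
    _ ≤ ε / (b - a + 1) * (b - a + 1) := by gcongr
    _ = ε := by field_simp

end UniformlySmall

/-! ### Convergence of velocities -/

/-- If curves `rₙ` converge pointwise and their velocities are Lipschitz up to an error tending to
zero, then the velocities converge to the velocity of the limit: both are close to the same
difference quotients. -/
theorem tendsto_velocity_of_almost_lipschitz {a b t L : ℝ} (hab : a < b) (ht : t ∈ Icc a b)
    (hL : 0 ≤ L) {r v : ℕ → ℝ → E3} {x : ℝ → E3} {w : E3}
    (hr : ∀ᶠ n in atTop, ∀ s ∈ Icc a b, HasDerivWithinAt (r n) (v n s) (Icc a b) s)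
    (hv : ∀ ε > 0, ∀ᶠ n in atTop, ∀ s ∈ Icc a b, ‖v n s - v n t‖ ≤ L * |s - t| + ε)
    (hrx : ∀ s ∈ Icc a b, Tendsto (fun n => r n s) atTop (𝓝 (x s)))
    (hx : HasDerivWithinAt x w (Icc a b) t) : Tendsto (fun n => v n t) atTop (𝓝 w) := by
  rw [Metric.tendsto_nhds]
  intro ε hε
  have hne : (𝓝[Icc a b \ {t}] t).NeBot :=
    accPt_principal_iff_nhdsWithin.1 (uniqueDiffWithinAt_iff_accPt.1 (uniqueDiffOn_Icc hab t ht))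
  have h1 : ∀ᶠ s in 𝓝[Icc a b \ {t}] t, dist (slope x t s) w < ε / 5 :=
    Metric.tendsto_nhds.1 (hasDerivWithinAt_iff_tendsto_slope.1 hx) _ (by positivity)
  have h2 : ∀ᶠ s in 𝓝[Icc a b \ {t}] t, L * |s - t| < ε / 5 := by
    have : Tendsto (fun s => L * |s - t|) (𝓝[Icc a b \ {t}] t) (𝓝 (L * |t - t|)) :=
      (Continuous.tendsto (by fun_prop) t).mono_left nhdsWithin_le_nhds
    refine this.eventually (gt_mem_nhds ?_)
    simp [hε]
  -- a time `s ≠ t` close to `t`, fixed before `n`: the difference quotients over `[t, s]` of `rₙ`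
  -- converge for this `s`, and they are close to `vₙ(t)` by the mean value inequality
  obtain ⟨s, ⟨hs1, hs2⟩, hsI, hst⟩ := ((h1.and h2).and self_mem_nhdsWithin).exists
  have hst' : 0 < |s - t| := abs_pos.2 (sub_ne_zero.2 hst)
  have h3 : Tendsto (fun n => slope (r n) t s) atTop (𝓝 (slope x t s)) := by
    simp only [slope_def_module]
    exact ((hrx s hsI).sub (hrx t ht)).const_smul _
  filter_upwards [hr, hv (ε / 5) (by positivity), Metric.tendsto_nhds.1 h3 (ε / 5) (by positivity)]
    with n hn1 hn2 hn3
  have hsub : uIcc t s ⊆ Icc a b := uIcc_subset_Icc ht hsI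
  have hmv := (convex_uIcc t s).norm_image_sub_le_of_norm_hasDerivWithin_le
    (f := fun y => r n y - y • v n t) (f' := fun y => v n y - v n t) (C := ε / 5 + ε / 5)
    (fun y hy => (((hn1 y (hsub hy)).mono hsub).sub
      ((hasDerivWithinAt_id y (uIcc t s)).smul_const (v n t))).congr_deriv (by simp))
    (fun y hy => by
      have hyt : |y - t| ≤ |s - t| := abs_sub_left_of_mem_uIcc hy
      have := mul_le_mul_of_nonneg_left hyt hL
      linarith [hn2 y (hsub hy)])
    left_mem_uIcc right_mem_uIcc
  have h4 : dist (v n t) (slope (r n) t s) ≤ ε / 5 + ε / 5 := by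
    rw [dist_comm, dist_eq_norm, slope_def_module]
    have h5 : (s - t)⁻¹ • (r n s - r n t) - v n t =
        (s - t)⁻¹ • (r n s - s • v n t - (r n t - t • v n t)) := by
      rw [show r n s - s • v n t - (r n t - t • v n t) = (r n s - r n t) - (s - t) • v n t by
        module, smul_sub (s - t)⁻¹ (r n s - r n t), inv_smul_smul₀ (sub_ne_zero.2 hst)]
    rw [h5, norm_smul, norm_inv, Real.norm_eq_abs, inv_mul_le_iff₀ hst', mul_comm]
    exact hmv
  linarith [dist_triangle4 (v n t) (slope (r n) t s) (slope x t s) w]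

namespace NLSSequence

variable {K : Constants} {γ : Trajectory} {N : Nonlinearity} {S : NLSSequence}
  {ψ : ℕ → ST → ℂ} {t₀ ρinf : ℝ}

namespace Concentrates

/-- The charge density has the sign of `q`, and the charges are positive. -/
theorem q_pos (h : S.Concentrates K γ N ψ t₀ ρinf) : 0 < K.q := by
  obtain ⟨C, c₀, hc₀, n₀, hn⟩ := h.charge_bounded
  by_contra hq
  have h1 := (hn n₀ le_rfl t₀ h.t₀_mem).1
  have h2 : S.charge K γ ψ n₀ t₀ ≤ 0 :=
    integral_nonpos fun x => mul_nonpos_of_nonpos_of_nonneg (not_lt.1 hq)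
      (Complex.normSq_nonneg _)
  linarith

theorem eventually_charge_pos (h : S.Concentrates K γ N ψ t₀ ρinf) :
    ∀ᶠ n in atTop, ∀ t ∈ γ.I, 0 < S.charge K γ ψ n t := by
  obtain ⟨C, c₀, hc₀, n₀, hn⟩ := h.charge_bounded
  filter_upwards [eventually_ge_atTop n₀] with n hn' t ht
  exact hc₀.trans_le (hn n hn' t ht).1

theorem ρinf_pos (h : S.Concentrates K γ N ψ t₀ ρinf) : 0 < ρinf := by
  obtain ⟨C, c₀, hc₀, n₀, hn⟩ := h.charge_bounded
  exact hc₀.trans_le (ge_of_tendsto h.charge_tendsto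
    ((eventually_ge_atTop n₀).mono fun n hn' => (hn n hn' t₀ h.t₀_mem).1))

theorem uniformlySmall_charge_sub (h : S.Concentrates K γ N ψ t₀ ρinf) :
    UniformlySmall γ.I fun n t => S.charge K γ ψ n t - ρinf := by
  have h1 : Tendsto (fun n => S.charge K γ ψ n t₀ - ρinf) atTop (𝓝 0) := by
    simpa using h.charge_tendsto.sub_const ρinf
  refine ((uniformlySmall_const h1).add (uniformlySmall_iff.2 h.Q23_tendsto)).congr
    (Eventually.of_forall fun n t ht => ?_)
  rw [h.charge_eq n ht]
  ring

/-- The velocities of the centers are bounded, by the bound on the momentum. -/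
theorem exists_centerVel_bound (h : S.Concentrates K γ N ψ t₀ ρinf) :
    ∃ V, 0 ≤ V ∧ ∀ᶠ n in atTop, ∀ t ∈ γ.I, ‖S.centerVel K γ ψ n t‖ ≤ V := by
  obtain ⟨C, c₀, hc₀, n₀, hn⟩ := h.charge_bounded
  obtain ⟨M, hM⟩ := h.momentum_bounded
  have hq := h.q_pos
  have hm := K.m_pos
  have hM0 : 0 ≤ M := (norm_nonneg _).trans (hM 0 t₀ h.t₀_mem)
  refine ⟨c₀⁻¹ * (K.q / K.m * M + 1 + 1), by positivity, ?_⟩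
  filter_upwards [h.eventually_charge_pos, eventually_ge_atTop n₀,
    uniformlySmall_iff.2 h.Q20_tendsto 1 one_pos, uniformlySmall_iff.2 h.Q22_tendsto 1 one_pos]
    with n hpos hn' h1 h2 t ht
  have h3 : S.totalCurrent K γ ψ n t = (K.q / K.m) • S.totalMomentum K γ ψ n t := by
    rw [totalMomentum_eq_smul_totalCurrent hq.ne', smul_smul,
      show K.q / K.m * (K.m * K.q⁻¹) = 1 by field_simp, one_smul]
  rw [centerVel, (h.hasDerivWithinAt_center hpos ht).derivWithin (γ.uniqueDiffOn_I t ht), norm_smul,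
    norm_inv, Real.norm_eq_abs, abs_of_pos (hpos t ht)]
  gcongr
  · exact (hn n hn' t ht).1
  · refine (norm_sub_le _ _).trans (add_le_add ((norm_sub_le _ _).trans (add_le_add ?_ (h1 t ht)))
      (h2 t ht))
    rw [h3, norm_smul, Real.norm_eq_abs, abs_of_pos (by positivity)]
    gcongr
    exact hM n t ht

/-- The total current is close to the limit charge times the velocity of the center. -/
theorem uniformlySmall_totalCurrent_sub (h : S.Concentrates K γ N ψ t₀ ρinf) :
    UniformlySmall γ.I fun n t =>
      S.totalCurrent K γ ψ n t - ρinf • S.centerVel K γ ψ n t := by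
  obtain ⟨V, -, hV⟩ := h.exists_centerVel_bound
  have h1 : UniformlySmall γ.I fun n t =>
      (S.charge K γ ψ n t - ρinf) • S.centerVel K γ ψ n t := by
    refine h.uniformlySmall_charge_sub.of_norm_le (C := V) ?_
    filter_upwards [hV] with n hn t ht
    rw [norm_smul, mul_comm]
    gcongr
    exact hn t ht
  refine ((h1.add (uniformlySmall_iff.2 h.Q20_tendsto)).add
    (uniformlySmall_iff.2 h.Q22_tendsto)).congr ?_
  filter_upwards [h.eventually_charge_pos] with n hpos t ht
  rw [h.totalCurrent_eq hpos ht]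
  module

/-- The limit Lorentz force `ρ_∞ E_∞ + ρ_∞ v × c⁻¹ B_∞` along a velocity field `v`. -/
def limitForce (K : Constants) (γ : Trajectory) (S : NLSSequence) (ρinf : ℝ) (v : ℝ → E3) (t : ℝ) :
    E3 := ρinf • S.Elim K γ t + ρinf • cross (v t) (K.c⁻¹ • S.Blim γ t)

theorem continuousOn_limitForce (h : S.Concentrates K γ N ψ t₀ ρinf) {v : ℝ → E3}
    (hv : ContinuousOn v γ.I) : ContinuousOn (limitForce K γ S ρinf v) γ.I :=
  (h.continuousOn_Elim.const_smul ρinf).add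
    ((hv.cross (h.continuousOn_Blim.const_smul K.c⁻¹)).const_smul ρinf)

/-- The error in the integrated equation of motion of the centers. -/
def motionError (K : Constants) (γ : Trajectory) (S : NLSSequence) (ψ : ℕ → ST → ℂ) (t₀ ρinf : ℝ)
    (n : ℕ) (t : ℝ) : E3 :=
  (K.m * K.q⁻¹ * ρinf) • S.centerVel K γ ψ n t -
    (∫ τ in t₀..t, limitForce K γ S ρinf (S.centerVel K γ ψ n) τ) - S.totalMomentum K γ ψ n t₀

/-- The error is the sum of the boundary terms, of the deviation of the fields from their limits,
and of the deviations of the charge from `ρ_∞` and of the total current from `ρ_∞ vₙ`. -/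
theorem uniformlySmall_motionError (h : S.Concentrates K γ N ψ t₀ ρinf) :
    UniformlySmall γ.I (motionError K γ S ψ t₀ ρinf) := by
  have hδ := h.uniformlySmall_totalCurrent_sub
  have hE := h.continuousOn_Elim
  have hB := h.continuousOn_Blim
  have hBc : ContinuousOn (fun t => K.c⁻¹ • S.Blim γ t) γ.I := hB.const_smul K.c⁻¹
  obtain ⟨CE, hCE⟩ := (isCompact_Icc (a := γ.Tm) (b := γ.Tp)).exists_bound_of_continuousOn hE
  obtain ⟨CB, hCB⟩ := (isCompact_Icc (a := γ.Tm) (b := γ.Tp)).exists_bound_of_continuousOn hBc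
  have h1 : UniformlySmall γ.I fun n t => -((K.m * K.q⁻¹) •
      (S.totalCurrent K γ ψ n t - ρinf • S.centerVel K γ ψ n t)) :=
    hδ.of_norm_le (C := ‖K.m * K.q⁻¹‖) (Eventually.of_forall fun n t _ => by
      rw [norm_neg, norm_smul])
  have h2 : UniformlySmall γ.I fun n t => (S.charge K γ ψ n t - ρinf) • S.Elim K γ t :=
    h.uniformlySmall_charge_sub.of_norm_le (C := CE) (Eventually.of_forall fun n t ht => by
      rw [norm_smul, mul_comm]
      gcongr
      exact hCE t ht)
  have h3 : UniformlySmall γ.I fun n t =>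
      cross (S.totalCurrent K γ ψ n t - ρinf • S.centerVel K γ ψ n t) (K.c⁻¹ • S.Blim γ t) :=
    hδ.of_norm_le (C := ‖crossL‖ * CB) (Eventually.of_forall fun n t ht => by
      refine (crossL.le_opNorm₂ _ _).trans ?_
      rw [mul_right_comm]
      gcongr
      exact hCB t ht)
  refine ((((h1.add (uniformlySmall_iff.2 h.Q0_tendsto)).add
    (uniformlySmall_iff.2 h.Q01_tendsto)).add (uniformlySmall_iff.2 h.Q3_tendsto)).add
      ((h2.add h3).integral h.t₀_mem)).congr ?_
  filter_upwards [h.eventually_charge_pos] with n hpos t ht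
  have hsub : uIcc t₀ t ⊆ γ.I := uIcc_subset_Icc h.t₀_mem ht
  have hv := h.continuousOn_centerVel hpos
  have hJ := h.continuousOn_totalCurrent n
  have hF := h.continuousOn_limitForce hv
  have hG : ContinuousOn (fun τ => S.charge K γ ψ n τ • S.Elim K γ τ +
      cross (S.totalCurrent K γ ψ n τ) (K.c⁻¹ • S.Blim γ τ)) γ.I :=
    ((h.continuousOn_charge n).smul hE).add (hJ.cross hBc)
  have hdiff : ∫ τ in t₀..t, ((S.charge K γ ψ n τ - ρinf) • S.Elim K γ τ +
      cross (S.totalCurrent K γ ψ n τ - ρinf • S.centerVel K γ ψ n τ) (K.c⁻¹ • S.Blim γ τ)) =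
      (∫ τ in t₀..t, (S.charge K γ ψ n τ • S.Elim K γ τ +
        cross (S.totalCurrent K γ ψ n τ) (K.c⁻¹ • S.Blim γ τ))) -
      ∫ τ in t₀..t, limitForce K γ S ρinf (S.centerVel K γ ψ n) τ := by
    rw [← intervalIntegral.integral_sub (hG.mono hsub).intervalIntegrable
      (hF.mono hsub).intervalIntegrable]
    refine intervalIntegral.integral_congr fun τ _ => ?_
    simp only [limitForce, ← crossL_apply, map_sub, map_smul, _root_.sub_apply, _root_.smul_apply]
    module
  have hmom := h.totalMomentum_eq n hE hB ht
  rw [totalMomentum_eq_smul_totalCurrent h.q_pos.ne' n t] at hmom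
  rw [hdiff, motionError, smul_sub, hmom]
  module

/-- The velocities of the centers converge to the velocity of the trajectory: by the integrated
equation of motion with a bounded force they are Lipschitz up to the motion error, and the centers
stay in the shrinking balls around the trajectory. -/
theorem tendsto_centerVel (h : S.Concentrates K γ N ψ t₀ ρinf) {t : ℝ} (ht : t ∈ γ.I) :
    Tendsto (fun n => S.centerVel K γ ψ n t) atTop (𝓝 (γ.vel t)) := by
  have hq := h.q_pos
  have hρ := h.ρinf_pos
  have hm := K.m_pos
  obtain ⟨V, hV0, hV⟩ := h.exists_centerVel_bound
  have hBc : ContinuousOn (fun t => K.c⁻¹ • S.Blim γ t) γ.I := h.continuousOn_Blim.const_smul K.c⁻¹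
  obtain ⟨CE, hCE⟩ := (isCompact_Icc (a := γ.Tm) (b := γ.Tp)).exists_bound_of_continuousOn
    h.continuousOn_Elim
  obtain ⟨CB, hCB⟩ := (isCompact_Icc (a := γ.Tm) (b := γ.Tp)).exists_bound_of_continuousOn hBc
  have hCE0 : 0 ≤ CE := (norm_nonneg _).trans (hCE t ht)
  have hCB0 : 0 ≤ CB := (norm_nonneg _).trans (hCB t ht)
  set A := K.m * K.q⁻¹ * ρinf
  have hA : 0 < A := by positivity
  set M := ρinf * CE + ρinf * (‖crossL‖ * V * CB)
  refine tendsto_velocity_of_almost_lipschitz (L := A⁻¹ * M) (r := S.center K γ ψ) γ.lt ht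
    (by positivity) ?_ (fun ε hε => ?_) (fun s hs => ?_) (γ.hasDerivWithinAt_pos ht)
  · filter_upwards [h.eventually_charge_pos] with n hpos s hs
    exact (h.hasDerivWithinAt_center hpos hs).differentiableWithinAt.hasDerivWithinAt
  · filter_upwards [h.eventually_charge_pos, hV,
      h.uniformlySmall_motionError (A * ε / 2) (by positivity)] with n hpos hVn hRn s hs
    have hF := h.continuousOn_limitForce (h.continuousOn_centerVel hpos)
    have hint : ∀ {a b : ℝ}, a ∈ γ.I → b ∈ γ.I → IntervalIntegrable
        (limitForce K γ S ρinf (S.centerVel K γ ψ n)) volume a b := fun ha hb =>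
      (hF.mono (uIcc_subset_Icc ha hb)).intervalIntegrable
    have hI : ‖∫ τ in t..s, limitForce K γ S ρinf (S.centerVel K γ ψ n) τ‖ ≤ M * |s - t| := by
      refine intervalIntegral.norm_integral_le_of_norm_le_const fun τ hτ => ?_
      have hτI : τ ∈ γ.I := uIcc_subset_Icc ht hs (uIoc_subset_uIcc hτ)
      refine (norm_add_le _ _).trans ?_
      rw [norm_smul, norm_smul, Real.norm_eq_abs, abs_of_pos hρ]
      have h1 := hCE τ hτI
      have h2 : ‖cross (S.centerVel K γ ψ n τ) (K.c⁻¹ • S.Blim γ τ)‖ ≤ ‖crossL‖ * V * CB := by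
        refine (crossL.le_opNorm₂ _ _).trans ?_
        gcongr
        · exact hVn τ hτI
        · exact hCB τ hτI
      simp only [M]
      gcongr
    have hsplit := intervalIntegral.integral_add_adjacent_intervals (hint h.t₀_mem ht) (hint ht hs)
    have heq : A • (S.centerVel K γ ψ n s - S.centerVel K γ ψ n t) =
        (∫ τ in t..s, limitForce K γ S ρinf (S.centerVel K γ ψ n) τ) +
          motionError K γ S ψ t₀ ρinf n s - motionError K γ S ψ t₀ ρinf n t := by
      simp only [motionError, ← hsplit, smul_sub, A]
      abel
    have hle : A * ‖S.centerVel K γ ψ n s - S.centerVel K γ ψ n t‖ ≤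
        M * |s - t| + A * ε / 2 + A * ε / 2 := by
      rw [← abs_of_pos hA, ← Real.norm_eq_abs, ← norm_smul, heq, Real.norm_eq_abs, abs_of_pos hA]
      exact (norm_sub_le _ _).trans (add_le_add ((norm_add_le _ _).trans
        (add_le_add hI (hRn s hs))) (hRn t ht))
    rw [← mul_le_mul_iff_right₀ hA]
    refine hle.trans_eq ?_
    field_simp
    ring
  · rw [tendsto_iff_norm_sub_tendsto_zero]
    refine squeeze_zero' (Eventually.of_forall fun n => norm_nonneg _) ?_ h.localized.R_tendsto
    filter_upwards [h.eventually_charge_pos] with n hpos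
    exact h.norm_center_sub_le hq hs (hpos s hs)

/-- The bounded momenta at time `t₀` have a convergent subsequence. -/
theorem exists_subseq_totalMomentum (h : S.Concentrates K γ N ψ t₀ ρinf) :
    ∃ (k : ℕ → ℕ) (pinf : E3), StrictMono k ∧
      Tendsto (fun j => S.totalMomentum K γ ψ (k j) t₀) atTop (𝓝 pinf) := by
  obtain ⟨M, hM⟩ := h.momentum_bounded
  obtain ⟨p, -, k, hk, hlim⟩ := (isCompact_closedBall (0 : E3) M).tendsto_subseq
    (x := fun n => S.totalMomentum K γ ψ n t₀) fun n => by simpa using hM n t₀ h.t₀_mem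
  exact ⟨k, p, hk, hlim⟩

/-- The limit of the integrated equation of motion, by dominated convergence. -/
theorem integrated_newton (h : S.Concentrates K γ N ψ t₀ ρinf) {k : ℕ → ℕ} {pinf : E3}
    (hk : StrictMono k)
    (hp : Tendsto (fun j => S.totalMomentum K γ ψ (k j) t₀) atTop (𝓝 pinf)) {t : ℝ}
    (ht : t ∈ γ.I) :
    (K.m * K.q⁻¹ * ρinf) • γ.vel t =
      (∫ τ in t₀..t, limitForce K γ S ρinf γ.vel τ) + pinf := by
  have hsub : uIoc t₀ t ⊆ γ.I := uIoc_subset_uIcc.trans (uIcc_subset_Icc h.t₀_mem ht)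
  obtain ⟨V, hV0, hV⟩ := h.exists_centerVel_bound
  have hlimF : ∀ τ ∈ γ.I, Tendsto (fun n => limitForce K γ S ρinf (S.centerVel K γ ψ n) τ) atTop
      (𝓝 (limitForce K γ S ρinf γ.vel τ)) := fun τ hτ =>
    tendsto_const_nhds.add ((((crossL.flip (K.c⁻¹ • S.Blim γ τ)).continuous.tendsto _).comp
      (h.tendsto_centerVel hτ)).const_smul ρinf)
  have hint : Tendsto (fun n => ∫ τ in t₀..t, limitForce K γ S ρinf (S.centerVel K γ ψ n) τ) atTop
      (𝓝 (∫ τ in t₀..t, limitForce K γ S ρinf γ.vel τ)) := by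
    have hBc : ContinuousOn (fun t => K.c⁻¹ • S.Blim γ t) γ.I :=
      h.continuousOn_Blim.const_smul K.c⁻¹
    refine intervalIntegral.tendsto_integral_filter_of_dominated_convergence
      (fun τ => ‖ρinf‖ * ‖S.Elim K γ τ‖ + ‖ρinf‖ * (‖crossL‖ * V * ‖K.c⁻¹ • S.Blim γ τ‖))
      ?_ ?_ ?_ ?_
    · filter_upwards [h.eventually_charge_pos] with n hpos
      exact ((h.continuousOn_limitForce (h.continuousOn_centerVel hpos)).mono
        hsub).aestronglyMeasurable measurableSet_uIoc
    · filter_upwards [hV] with n hVn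
      refine Eventually.of_forall fun τ hτ => (norm_add_le _ _).trans ?_
      rw [norm_smul, norm_smul]
      gcongr
      refine (crossL.le_opNorm₂ _ _).trans ?_
      gcongr
      exact hVn τ (hsub hτ)
    · refine ContinuousOn.intervalIntegrable (ContinuousOn.mono ?_ (uIcc_subset_Icc h.t₀_mem ht))
      exact (continuousOn_const.mul h.continuousOn_Elim.norm).add
        (continuousOn_const.mul (continuousOn_const.mul hBc.norm))
    · exact Eventually.of_forall fun τ hτ => hlimF τ (hsub hτ)
  have hR : Tendsto (fun n => motionError K γ S ψ t₀ ρinf n t) atTop (𝓝 0) := by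
    have := uniformlySmall_iff.1 h.uniformlySmall_motionError
    exact this.tendsto_at ht
  have hlim := (((h.tendsto_centerVel ht).const_smul (K.m * K.q⁻¹ * ρinf)).sub hint).sub hR
  have hlim' := (hlim.comp hk.tendsto_atTop).congr (f₂ := fun j => S.totalMomentum K γ ψ (k j) t₀)
    fun j => by
      simp only [Function.comp, motionError]
      abel
  have := tendsto_nhds_unique hlim' hp
  rw [sub_zero, sub_eq_iff_eq_add] at this
  rw [this, add_comm]

/-- Newton's law for the trajectory: the derivative of the limit equation, divided by the limit
charge. -/
theorem newton (h : S.Concentrates K γ N ψ t₀ ρinf) {t : ℝ} (ht : t ∈ γ.I) :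
    K.m • γ.acc t = K.q • S.Elim K γ t + (K.q / K.c) • cross (γ.vel t) (S.Blim γ t) := by
  have hq := h.q_pos
  have hρ := h.ρinf_pos
  have hm := K.m_pos
  have hc := K.c_pos
  obtain ⟨k, pinf, hk, hp⟩ := h.exists_subseq_totalMomentum
  have hF := h.continuousOn_limitForce γ.continuousOn_vel
  have : Fact (t ∈ Icc γ.Tm γ.Tp) := ⟨ht⟩
  have hd : HasDerivWithinAt (fun t => ∫ τ in t₀..t, limitForce K γ S ρinf γ.vel τ)
      (limitForce K γ S ρinf γ.vel t) (Icc γ.Tm γ.Tp) t :=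
    intervalIntegral.integral_hasDerivWithinAt_right
      ((hF.mono (uIcc_subset_Icc h.t₀_mem ht)).intervalIntegrable)
      (hF.stronglyMeasurableAtFilter_nhdsWithin measurableSet_Icc t) (hF t ht)
  have hA : K.m * K.q⁻¹ * ρinf ≠ 0 := by positivity
  have hvel : ∀ s ∈ γ.I, γ.vel s = (K.m * K.q⁻¹ * ρinf)⁻¹ •
      ((∫ τ in t₀..s, limitForce K γ S ρinf γ.vel τ) + pinf) := fun s hs => by
    rw [← h.integrated_newton hk hp hs, inv_smul_smul₀ hA]
  have hacc : γ.acc t = (K.m * K.q⁻¹ * ρinf)⁻¹ • limitForce K γ S ρinf γ.vel t :=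
    (((hd.add_const pinf).const_smul (K.m * K.q⁻¹ * ρinf)⁻¹).congr_of_mem hvel ht).derivWithin
      (γ.uniqueDiffOn_I t ht)
  have hcross : cross (γ.vel t) (K.c⁻¹ • S.Blim γ t) = K.c⁻¹ • cross (γ.vel t) (S.Blim γ t) := by
    rw [← crossL_apply, map_smul, crossL_apply]
  rw [hacc, limitForce, hcross]
  simp only [smul_add, smul_smul]
  congr 2 <;> field_simp

end Concentrates

end NLSSequence

end NLSPoint

end

theorem mainTheorem3 (K : NLSPoint.Constants) (γ : NLSPoint.Trajectory)
    (N : NLSPoint.Nonlinearity) (S : NLSPoint.NLSSequence) (ψ : ℕ → NLSPoint.ST → ℂ)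
    (t₀ ρinf : ℝ) (h : S.Concentrates K γ N ψ t₀ ρinf) :
    -- the limit fields and the velocities of the adjacent centers are well defined and continuous
    (ContinuousOn (S.Elim K γ) γ.I ∧ ContinuousOn (S.Blim γ) γ.I ∧
      ∀ᶠ n in atTop, ContDiffOn ℝ 1 (S.center K γ ψ n) γ.I) ∧
    -- the momenta at time `t₀` converge along a subsequence
    (∃ (k : ℕ → ℕ) (pinf : NLSPoint.E3), StrictMono k ∧
      Tendsto (fun j => S.totalMomentum K γ ψ (k j) t₀) atTop (𝓝 pinf)) ∧
    -- along every such subsequence the integral equation holds up to a uniformly small error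
    (∀ (k : ℕ → ℕ) (pinf : NLSPoint.E3), StrictMono k →
      Tendsto (fun j => S.totalMomentum K γ ψ (k j) t₀) atTop (𝓝 pinf) →
      ∃ Q6 : ℕ → ℝ → NLSPoint.E3,
        TendstoUniformlyOn Q6 (fun _ => 0) atTop γ.I ∧
        ∀ᶠ j in atTop, ∀ t ∈ γ.I,
          (K.m * K.q⁻¹ * ρinf) • S.centerVel K γ ψ (k j) t =
            (∫ τ in t₀..t, (ρinf • S.Elim K γ τ +
              ρinf • NLSPoint.cross (S.centerVel K γ ψ (k j) τ) (K.c⁻¹ • S.Blim γ τ))) +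
            pinf + Q6 j t) ∧
    -- Newton's law with the limit Lorentz force
    (∀ t ∈ γ.I,
      K.m • γ.acc t =
        K.q • S.Elim K γ t + (K.q / K.c) • NLSPoint.cross (γ.vel t) (S.Blim γ t)) := by
  refine ⟨⟨h.continuousOn_Elim, h.continuousOn_Blim, ?_⟩, h.exists_subseq_totalMomentum,
    fun k pinf hk hp => ?_, fun t ht => h.newton ht⟩
  · filter_upwards [h.eventually_charge_pos] with n hpos using h.contDiffOn_center hpos
  · -- the error `Q₆` is the motion error plus the difference of the momentum at `t₀` and `p_∞`
    have hp0 : Tendsto (fun j => S.totalMomentum K γ ψ (k j) t₀ - pinf) atTop (𝓝 0) := by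
      simpa using hp.sub_const pinf
    refine ⟨_, NLSPoint.uniformlySmall_iff.1 ((h.uniformlySmall_motionError.comp hk).add
      (NLSPoint.uniformlySmall_const hp0)), Eventually.of_forall fun j t _ => ?_⟩
    simp only [NLSPoint.NLSSequence.Concentrates.motionError,
      NLSPoint.NLSSequence.Concentrates.limitForce]
    abel
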